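/- Let $\mathrm{Sh}$ be the Shrikhande graph, i.e. the graph on $\mathbb{Z}_4^2$ in which two vertices are adjacent if and only if their difference is one of $\pm(1,0)$, $\pm(0,1)$, $\pm(1,1)$. For integers $m,n\ge 0$ let $D(m,n)=\mathrm{Sh}^m\times K_4^n$ be the Cartesian product of $m$ copies of $\mathrm{Sh}$ and $n$ copies of the complete graph $K_4$ (a Doob graph if $m>0$, the Hamming graph $H(n,4)$ if $m=0$). Then the number of maximum independent sets (distance-$2$ MDS codes), that is, of independent sets of largest cardinality, in $D(m,n)$ is $$2^{2^{2m+n-1}(1+o(1))}\qquad\text{as } 2m+n\to\infty,$$ i.e. it equals $2^{2^{2m+n-1}(1+\varepsilon(m,n))}$ with real numbers $\varepsilon(m,n)$ such that for every $\delta>0$ there is an $N$ with $|\varepsilon(m,n)|<\delta$ for all $m,n\ge 0$ with $2m+n\ge N$. -/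

import Mathlib

namespace DoobGraph

/-- The Shrikhande graph: the Cayley graph on `ℤ₄ × ℤ₄` with connection set
`{±(1,0), ±(0,1), ±(1,1)}`; the negatives are supplied by `circulantGraph`. -/
def shrikhande : SimpleGraph (ZMod 4 × ZMod 4) :=
  SimpleGraph.circulantGraph {(1, 0), (0, 1), (1, 1)}

/-- The Cartesian power of `k` copies of `G`: two tuples are adjacent when they are adjacent in
exactly one coordinate and agree in all the others. -/
def cartesianPower {V : Type*} (G : SimpleGraph V) (k : ℕ) : SimpleGraph (Fin k → V) where
  Adj x y := ∃ i, G.Adj (x i) (y i) ∧ ∀ j, j ≠ i → x j = y j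
  symm := ⟨fun _ _ ⟨i, h, h'⟩ => ⟨i, h.symm, fun j hj => (h' j hj).symm⟩⟩
  loopless := ⟨fun _ ⟨_, h, _⟩ => h.ne rfl⟩

/-- The graph `D(m, n)`, the Cartesian product of `m` copies of the Shrikhande graph and `n`
copies of the complete graph `K₄`. -/
def doob (m n : ℕ) : SimpleGraph ((Fin m → ZMod 4 × ZMod 4) × (Fin n → Fin 4)) :=
  (cartesianPower shrikhande m).boxProd (cartesianPower (⊤ : SimpleGraph (Fin 4)) n)

/-- The number of maximum independent sets (independent sets of largest cardinality) of
`D(m, n)`. -/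
noncomputable def numMDS (m n : ℕ) : ℕ :=
  {S : Finset ((Fin m → ZMod 4 × ZMod 4) × (Fin n → Fin 4)) |
    (doob m n).IsMaximumIndepSet S}.ncard

end DoobGraph

/-! Put `N = 2m + n ≥ 1`. Maximum independent sets are those with a quarter of the vertices.

Lower bound. The vertices split into `2 ^ N` blocks, products of 4-cycles and edges. Adjacent
vertices lie in blocks of opposite parity, or in one block and in opposite classes of its
bipartition. Choosing a class in each of the at least `2 ^ (N - 1)` even blocks gives distinct
maximum sets (`two_pow_le_numMDS`).

Upper bound. The sixteen independent quadruples of the Shrikhande graph embed into the permutations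
of four letters, seen as independent sets of `K₄ × K₄`, with disjointness preserved. This reduces
the count to the Hamming graph, where the sets become codes with one point on every line.

A Linial–Luria bound shows that, in length `k`, the codes inside `U` times the codes inside `Uᶜ`
number at most `2 ^ (2 ^ k)`. Hence at most `2 ^ (2 ^ (N - 1))` codes have a prescribed union of
layers 2 and 3. That union is a double-code, determined by any nonempty subset meeting each line in
0 or 2 points, and small such subsets are few. So codes whose union contains a small one
("splittable") obey the desired bound. Any other code is recovered cheaply from layers 0 and 1.
Iterating layers 0 and 1 down a binary tree leaves a code at each vertex of a cube, neighbouring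
codes being disjoint; such families again number at most `2 ^ (2 ^ (N - 1) * (1 + o(1)))`
(`card_cubeHoms_sq_le`).

The two counts are combined by bootstrapping (`EventuallyBounded.improve`): an exponent `(1 + t) * 2
^ (N - 1)` improves to `(1 + t / (1 + t) + δ) * 2 ^ (N - 1)`, and the only fixed point of `t ↦ t /
(1 + t)` with `t ≥ 0` is zero. -/

namespace DoobGraph

/-! ### Independent quadruples of the Shrikhande graph, coded by permutations -/

section Shrikhande

/-- Adjacency in the Shrikhande graph as a decidable relation. -/
def shAdj (u v : ZMod 4 × ZMod 4) : Bool :=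
  decide (u - v ∈ [((1 : ZMod 4), (0 : ZMod 4)), (0, 1), (1, 1), (3, 0), (0, 3), (3, 3)])

theorem shrikhande_adj_iff (u v : ZMod 4 × ZMod 4) : shrikhande.Adj u v ↔ shAdj u v = true := by
  simp only [shrikhande, SimpleGraph.circulantGraph, SimpleGraph.fromRel_adj, Set.mem_insert_iff,
    Set.mem_singleton_iff]
  revert u v
  decide +kernel

/-- The sixteen independent sets of size four of the Shrikhande graph. -/
def shIndep : Fin 16 → Finset (ZMod 4 × ZMod 4) :=
  ![{(0, 0), (0, 2), (2, 0), (2, 2)}, {(0, 0), (0, 2), (2, 1), (2, 3)},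
    {(0, 0), (1, 2), (2, 0), (3, 2)}, {(0, 0), (1, 3), (2, 2), (3, 1)},
    {(0, 1), (0, 3), (2, 0), (2, 2)}, {(0, 1), (0, 3), (2, 1), (2, 3)},
    {(0, 1), (1, 0), (2, 3), (3, 2)}, {(0, 1), (1, 3), (2, 1), (3, 3)},
    {(0, 2), (1, 0), (2, 2), (3, 0)}, {(0, 2), (1, 1), (2, 0), (3, 3)},
    {(0, 3), (1, 1), (2, 3), (3, 1)}, {(0, 3), (1, 2), (2, 1), (3, 0)},
    {(1, 0), (1, 2), (3, 0), (3, 2)}, {(1, 0), (1, 2), (3, 1), (3, 3)},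
    {(1, 1), (1, 3), (3, 0), (3, 2)}, {(1, 1), (1, 3), (3, 1), (3, 3)}]

/-- Sixteen permutations of four letters, in correspondence with `shIndep`. -/
def shPerm : Fin 16 → Fin 4 → Fin 4 :=
  ![![0, 1, 2, 3], ![0, 1, 3, 2], ![0, 2, 1, 3], ![0, 3, 2, 1], ![1, 0, 2, 3], ![1, 0, 3, 2],
    ![1, 2, 3, 0], ![1, 3, 0, 2], ![3, 1, 2, 0], ![2, 1, 0, 3], ![2, 0, 3, 1], ![3, 0, 1, 2],
    ![3, 2, 1, 0], ![2, 3, 1, 0], ![3, 2, 0, 1], ![2, 3, 0, 1]]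

theorem shPerm_injective : Function.Injective shPerm := by decide +kernel

theorem shPerm_apply_injective : ∀ i, Function.Injective (shPerm i) := by decide +kernel

/-- Slices of an independent set over adjacent vertices of the other factor are disjoint; the
permutations coding them must then be nowhere equal, so that their graphs are disjoint in `K₄ × K₄`.
-/
theorem shPerm_ne_of_disjoint :
    ∀ i j, Disjoint (shIndep i) (shIndep j) → ∀ a, shPerm i a ≠ shPerm j a := by decide +kernel

/-- Distinct and not adjacent in the Shrikhande graph. -/
def shSep (u v : ZMod 4 × ZMod 4) : Bool := decide (u ≠ v) && !shAdj u v

/-- Each hypothesis follows immediately the vertex it constrains, so that `decide` abandons a branch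
before quantifying over the next vertex. -/
theorem exists_subset_shIndep_of_shSep :
    ∀ a b, shSep a b = true → ∀ c, (shSep a c && shSep b c) = true →
    ∀ d, (shSep a d && shSep b d && shSep c d) = true →
    ∃ i, {a, b, c, d} ⊆ shIndep i := by
  decide +kernel

theorem card_shIndep : ∀ i, (shIndep i).card = 4 := by decide +kernel

/-- Every quadruple dominates the graph, so none extends to a fifth point. -/
theorem exists_shAdj_of_notMem :
    ∀ i, ∀ a, a ∉ shIndep i → ∃ b ∈ shIndep i, shAdj a b = true := by
  decide +kernel

theorem exists_shIndep_eq {S : Finset (ZMod 4 × ZMod 4)}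
    (hS : shrikhande.IsIndepSet (S : Set (ZMod 4 × ZMod 4))) (h4 : S.card = 4) :
    ∃ i, shIndep i = S := by
  obtain ⟨a, T, haT, rfl, hT⟩ := Finset.card_eq_succ.1 h4
  obtain ⟨b, c, d, hbc, hbd, hcd, rfl⟩ := Finset.card_eq_three.1 hT
  have key : ∀ u ∈ insert a ({b, c, d} : Finset _), ∀ v ∈ insert a ({b, c, d} : Finset _),
      u ≠ v → shSep u v = true := by
    intro u hu v hv huv
    have : ¬ shrikhande.Adj u v := hS (Finset.mem_coe.2 hu) (Finset.mem_coe.2 hv) huv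
    rw [shrikhande_adj_iff] at this
    simp [shSep, huv, this]
  simp only [Finset.mem_insert, Finset.mem_singleton, not_or] at haT
  obtain ⟨i, hi⟩ := exists_subset_shIndep_of_shSep a b (key a (by simp) b (by simp) haT.1)
    c (by rw [key a (by simp) c (by simp) haT.2.1, key b (by simp) c (by simp) hbc]; rfl)
    d (by rw [key a (by simp) d (by simp) haT.2.2, key b (by simp) d (by simp) hbd,
      key c (by simp) d (by simp) hcd]; rfl)
  exact ⟨i, (Finset.eq_of_subset_of_card_le hi (by rw [card_shIndep, h4])).symm⟩

theorem card_le_four_of_isIndepSet {S : Finset (ZMod 4 × ZMod 4)}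
    (hS : shrikhande.IsIndepSet (S : Set (ZMod 4 × ZMod 4))) : S.card ≤ 4 := by
  by_contra h
  obtain ⟨T, hTS, hT⟩ := Finset.exists_subset_card_eq (show 4 ≤ S.card by omega)
  obtain ⟨i, rfl⟩ := exists_shIndep_eq (hS.mono (Finset.coe_subset.2 hTS)) hT
  obtain ⟨a, haS, ha⟩ := Finset.exists_mem_notMem_of_card_lt_card
    (show (shIndep i).card < S.card by omega)
  obtain ⟨b, hb, hab⟩ := exists_shAdj_of_notMem i a ha
  have hne : a ≠ b := fun h => ha (h ▸ hb)
  exact hS (Finset.mem_coe.2 haS) (Finset.mem_coe.2 (hTS hb)) hne ((shrikhande_adj_iff a b).2 hab)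

/-! ### Parities on the two kinds of factor -/

/-- Reduction modulo two. -/
def parity : ZMod 4 → ZMod 2 := ![0, 1, 0, 1]

/-- The part of a letter in the partition `{0, 1}, {2, 3}`. -/
def high : Fin 4 → ZMod 2 := ![0, 0, 1, 1]

/-- The position of a letter inside its part. -/
def low : Fin 4 → ZMod 2 := ![0, 1, 0, 1]

theorem parity_add_one : ∀ a, parity (a + 1) = parity a + 1 := by decide

theorem high_surjective : Function.Surjective high := by decide

/-- Differences `±(0,1)` and `±(1,1)` change the second coordinate by an odd amount; `±(1,0)` moves
along a 4-cycle with fixed second coordinate. -/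
theorem parity_ne_of_shAdj : ∀ u v, shAdj u v = true →
    parity u.2 ≠ parity v.2 ∨ (u.2 = v.2 ∧ parity u.1 ≠ parity v.1) := by decide +kernel

theorem high_ne_of_ne : ∀ a b, a ≠ b → high a ≠ high b ∨ (high a = high b ∧ low a ≠ low b) := by
  decide

end Shrikhande

/-! ### Words, layers, fibers and line conditions -/

noncomputable section

open Finset

open scoped Classical

/-- Words of length `n` over a four-letter alphabet, as an iterated product. -/
def Word : ℕ → Type
  | 0 => Unit
  | n + 1 => Fin 4 × Word n

instance instFintypeWord : ∀ n, Fintype (Word n)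
  | 0 => inferInstanceAs (Fintype Unit)
  | n + 1 => @instFintypeProd (Fin 4) (Word n) _ (instFintypeWord n)

theorem card_word (n : ℕ) : Fintype.card (Word n) = 4 ^ n := by
  induction n with
  | zero => rfl
  | succ n ih =>
    have : Fintype.card (Word (n + 1)) = Fintype.card (Fin 4 × Word n) := rfl
    rw [this, Fintype.card_prod, ih, Fintype.card_fin, pow_succ, mul_comm]

/-- Prefix a letter to a word. -/
def Word.cons {n : ℕ} (a : Fin 4) (x : Word n) : Word (n + 1) := (a, x)

instance instNonemptyWord (n : ℕ) : Nonempty (Word n) :=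
  Fintype.card_pos_iff.1 (by rw [card_word]; positivity)

/-- The words `x` such that `a` followed by `x` lies in `M`. -/
def layer {n : ℕ} (M : Finset (Word (n + 1))) (a : Fin 4) : Finset (Word n) :=
  univ.filter fun x => Word.cons a x ∈ M

/-- The letters `a` such that `a` followed by `x` lies in `M`. -/
def fiber {n : ℕ} (M : Finset (Word (n + 1))) (x : Word n) : Finset (Fin 4) :=
  univ.filter fun a => Word.cons a x ∈ M

theorem mem_fiber_iff_mem_layer {n : ℕ} {M : Finset (Word (n + 1))} {a : Fin 4} {x : Word n} :
    a ∈ fiber M x ↔ x ∈ layer M a := by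
  simp [layer, fiber]

theorem ext_layer {n : ℕ} {M M' : Finset (Word (n + 1))} (h : ∀ a, layer M a = layer M' a) :
    M = M' := by
  ext ⟨a, x⟩
  have : x ∈ layer M a ↔ x ∈ layer M' a := by rw [h a]
  simp only [layer, mem_filter, mem_univ, true_and] at this
  exact this

theorem subset_iff_layer {n : ℕ} {M M' : Finset (Word (n + 1))} :
    M ⊆ M' ↔ ∀ a, layer M a ⊆ layer M' a := by
  constructor
  · intro h a x hx
    simp only [layer, mem_filter, mem_univ, true_and] at hx ⊢
    exact h hx
  · rintro h ⟨a, x⟩ hx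
    have := @h a x
    simp only [layer, mem_filter, mem_univ, true_and] at this
    exact this hx

theorem layer_mono {n : ℕ} {M M' : Finset (Word (n + 1))} (h : M ⊆ M') (a : Fin 4) :
    layer M a ⊆ layer M' a := subset_iff_layer.1 h a

theorem fiber_mono {n : ℕ} {M M' : Finset (Word (n + 1))} (h : M ⊆ M') (x : Word n) :
    fiber M x ⊆ fiber M' x := by
  intro a
  rw [mem_fiber_iff_mem_layer, mem_fiber_iff_mem_layer]
  exact fun ha => layer_mono h a ha

theorem layer_nonempty {n : ℕ} {M : Finset (Word (n + 1))} (h : M.Nonempty) :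
    ∃ a, (layer M a).Nonempty := by
  obtain ⟨⟨a, x⟩, hx⟩ := h
  exact ⟨a, x, by simp only [layer, mem_filter, mem_univ, true_and]; exact hx⟩

theorem card_eq_sum_layer {n : ℕ} (M : Finset (Word (n + 1))) :
    M.card = ∑ a, (layer M a).card := by
  have h : M.card = ∑ p : Fin 4 × Word n, if Word.cons p.1 p.2 ∈ M then 1 else 0 := by
    have : M.card = ∑ p : Word (n + 1), if p ∈ M then 1 else 0 := by simp
    exact this
  rw [h, Fintype.sum_prod_type]
  refine sum_congr rfl fun a _ => ?_
  rw [Finset.sum_boole]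
  rfl

theorem card_eq_sum_fiber {n : ℕ} (M : Finset (Word (n + 1))) :
    M.card = ∑ x, (fiber M x).card := by
  have h : M.card = ∑ p : Fin 4 × Word n, if Word.cons p.1 p.2 ∈ M then 1 else 0 := by
    have : M.card = ∑ p : Word (n + 1), if p ∈ M then 1 else 0 := by simp
    exact this
  rw [h, Fintype.sum_prod_type_right]
  refine sum_congr rfl fun a _ => ?_
  rw [Finset.sum_boole]
  rfl

/-- The sets of words that meet every line in a number of points satisfying `p`. -/
def LineCard (p : ℕ → Prop) : ∀ n, Finset (Word n) → Prop
  -- In length zero there are no lines, so both subsets of the one-point space qualify;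
  -- `IsCode.card_eq` and the code bounds therefore start at length one.
  | 0, _ => True
  | n + 1, M => (∀ a, LineCard p n (layer M a)) ∧ ∀ x, p (fiber M x).card

/-- Distance-2 MDS codes: exactly one point on every line. -/
abbrev IsCode (n : ℕ) (M : Finset (Word n)) : Prop := LineCard (· = 1) n M

/-- Double-codes: exactly two points on every line. -/
abbrev IsDouble (n : ℕ) (M : Finset (Word n)) : Prop := LineCard (· = 2) n M

/-- Sets with no point or exactly two points on every line. -/
abbrev IsEmptyOrPair (n : ℕ) (M : Finset (Word n)) : Prop := LineCard (fun k => k = 0 ∨ k = 2) n M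

/-- The number of codes contained in `U`. -/
def codeCount {n : ℕ} (U : Finset (Word n)) : ℕ :=
  (univ.filter fun M : Finset (Word n) => IsCode n M ∧ M ⊆ U).card

theorem IsCode.card_eq {n : ℕ} {M : Finset (Word (n + 1))} (h : IsCode (n + 1) M) :
    M.card = 4 ^ n := by
  rw [card_eq_sum_fiber, sum_congr rfl fun x _ => h.2 x]
  simp [card_word]

theorem IsCode.existsUnique_mem_layer {n : ℕ} {M : Finset (Word (n + 1))} (h : IsCode (n + 1) M)
    (x : Word n) : ∃ a, x ∈ layer M a ∧ ∀ b, x ∈ layer M b → b = a := by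
  obtain ⟨a, ha⟩ := Finset.card_eq_one.1 (h.2 x)
  refine ⟨a, mem_fiber_iff_mem_layer.1 (by simp [ha]), fun b hb => ?_⟩
  have := mem_fiber_iff_mem_layer.2 hb
  simpa [ha] using this

theorem IsCode.disjoint_layer {n : ℕ} {M : Finset (Word (n + 1))} (h : IsCode (n + 1) M)
    {a b : Fin 4} (hab : a ≠ b) : Disjoint (layer M a) (layer M b) := by
  rw [Finset.disjoint_left]
  intro x hx hx'
  obtain ⟨c, -, hc⟩ := h.existsUnique_mem_layer x
  exact hab ((hc a hx).trans (hc b hx').symm)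

/-! ### A Linial–Luria bound for codes inside a prescribed set -/

/-- Weight assigned to the choice of a code in `V`, of total mass at most one by
`codeCount_le`. -/
def codeWeight {n : ℕ} (V P : Finset (Word (n + 1))) : ℝ :=
  if IsCode (n + 1) P ∧ P ⊆ V then (2 : ℝ) ^ (-(((V.card : ℝ) - 4 ^ n) / 2 ^ n)) else 0

theorem codeWeight_nonneg {n : ℕ} (V P : Finset (Word (n + 1))) : 0 ≤ codeWeight V P := by
  unfold codeWeight
  split_ifs <;> positivity

theorem sum_codeWeight {n : ℕ} (V : Finset (Word (n + 1))) :
    ∑ P, codeWeight V P = codeCount V * (2 : ℝ) ^ (-(((V.card : ℝ) - 4 ^ n) / 2 ^ n)) := by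
  unfold codeWeight codeCount
  rw [← Finset.sum_filter, Finset.sum_const, nsmul_eq_mul]

/-- If `∑ g ≤ 1` at each of four successive choices, the product weights have total at most 1. -/
theorem sum_iterated_le_one {α : Type*} [Fintype α] (g₀ : α → ℝ) (g₁ : α → α → ℝ)
    (g₂ : α → α → α → ℝ) (g₃ : α → α → α → α → ℝ)
    (n₀ : ∀ a, 0 ≤ g₀ a) (n₁ : ∀ a b, 0 ≤ g₁ a b) (n₂ : ∀ a b c, 0 ≤ g₂ a b c)
    (h₀ : ∑ a, g₀ a ≤ 1) (h₁ : ∀ a, ∑ b, g₁ a b ≤ 1)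
    (h₂ : ∀ a b, ∑ c, g₂ a b c ≤ 1) (h₃ : ∀ a b c, ∑ d, g₃ a b c d ≤ 1) :
    ∑ p : α × α × α × α, g₀ p.1 * (g₁ p.1 p.2.1 * (g₂ p.1 p.2.1 p.2.2.1 *
      g₃ p.1 p.2.1 p.2.2.1 p.2.2.2)) ≤ 1 := by
  have key : ∀ (g f : α → ℝ), (∀ a, 0 ≤ g a) → (∑ a, g a ≤ 1) → (∀ a, f a ≤ 1) →
      ∑ a, g a * f a ≤ 1 := fun g f hg h hf =>
    (sum_le_sum fun a _ => mul_le_of_le_one_right (hg a) (hf a)).trans h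
  simp only [Fintype.sum_prod_type, ← Finset.mul_sum]
  exact key _ _ n₀ h₀ fun a => key _ _ (n₁ a) (h₁ a) fun b => key _ _ (n₂ a b) (h₂ a b) fun c =>
    h₃ a b c

theorem sum_codeWeight_layers_le_one {n : ℕ}
    (ih : ∀ U : Finset (Word (n + 1)), ∑ P, codeWeight U P ≤ 1)
    (V : Fin 4 → Finset (Word (n + 1))) (σ : Equiv.Perm (Fin 4))
    (S : Finset (Finset (Word (n + 2)))) :
    ∑ M ∈ S, codeWeight (V (σ 0)) (layer M (σ 0)) *
      (codeWeight (V (σ 1) \ layer M (σ 0)) (layer M (σ 1)) *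
      (codeWeight (V (σ 2) \ (layer M (σ 0) ∪ layer M (σ 1))) (layer M (σ 2)) *
      codeWeight (V (σ 3) \ (layer M (σ 0) ∪ layer M (σ 1) ∪ layer M (σ 2)))
        (layer M (σ 3)))) ≤ 1 := by
  refine le_trans ?_ (sum_iterated_le_one (α := Finset (Word (n + 1)))
    (fun a => codeWeight (V (σ 0)) a) (fun a b => codeWeight (V (σ 1) \ a) b)
    (fun a b c => codeWeight (V (σ 2) \ (a ∪ b)) c)
    (fun a b c d => codeWeight (V (σ 3) \ (a ∪ b ∪ c)) d)
    (fun _ => codeWeight_nonneg _ _) (fun _ _ => codeWeight_nonneg _ _)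
    (fun _ _ _ => codeWeight_nonneg _ _) (ih _) (fun _ => ih _) (fun _ _ => ih _)
    (fun _ _ _ => ih _))
  let e : Finset (Word (n + 2)) → Finset (Word (n + 1)) × Finset (Word (n + 1)) ×
      Finset (Word (n + 1)) × Finset (Word (n + 1)) := fun M =>
    (layer M (σ 0), layer M (σ 1), layer M (σ 2), layer M (σ 3))
  have he : Function.Injective e := by
    intro M M' h
    simp only [e, Prod.mk.injEq] at h
    refine ext_layer fun a => ?_
    obtain ⟨b, rfl⟩ := σ.surjective a
    fin_cases b
    exacts [h.1, h.2.1, h.2.2.1, h.2.2.2]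
  have := Finset.sum_image (s := S) (g := e) (f := fun p =>
    codeWeight (V (σ 0)) p.1 * (codeWeight (V (σ 1) \ p.1) p.2.1 *
      (codeWeight (V (σ 2) \ (p.1 ∪ p.2.1)) p.2.2.1 *
      codeWeight (V (σ 3) \ (p.1 ∪ p.2.1 ∪ p.2.2.1)) p.2.2.2))) he.injOn
  rw [← this]
  refine sum_le_sum_of_subset_of_nonneg (subset_univ _) fun p _ _ => ?_
  exact mul_nonneg (codeWeight_nonneg _ _) (mul_nonneg (codeWeight_nonneg _ _)
    (mul_nonneg (codeWeight_nonneg _ _) (codeWeight_nonneg _ _)))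

/-- `A` and `B` stand for the layers chosen before `P` in some order and in the reversed order. With
`P` they fill the space, so the points of `U` outside both are those of `P`. -/
theorem card_sdiff_add_card_sdiff {α : Type*} (U P A B : Finset α) (hP : P ⊆ U)
    (hA : Disjoint P A) (hB : Disjoint P B) (hAB : Disjoint A B) (h : ∀ x, x ∈ P ∪ A ∪ B) :
    (U \ A).card + (U \ B).card = U.card + P.card := by
  have h1 : (U \ A) ∪ (U \ B) = U := by
    ext x
    have : x ∈ A → x ∉ B := fun h => Finset.disjoint_left.1 hAB h
    simp only [mem_union, mem_sdiff]
    tauto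
  have h2 : (U \ A) ∩ (U \ B) = P := by
    ext x
    have h1 : x ∈ P → x ∉ A := fun h => Finset.disjoint_left.1 hA h
    have h2 : x ∈ P → x ∉ B := fun h => Finset.disjoint_left.1 hB h
    have h3 := h x
    have h4 := @hP x
    simp only [mem_union, mem_sdiff, mem_inter] at *
    tauto
  rw [← Finset.card_union_add_card_inter, h1, h2]

/-- Induction on the length. Choosing the four layers in turn, each avoiding the earlier ones, gives
product weights of total mass at most one. The weight of a code is the geometric mean of its product
weights for an order and for the reversal, so these two orders suffice. -/
theorem sum_codeWeight_le_one (n : ℕ) (U : Finset (Word (n + 1))) : ∑ P, codeWeight U P ≤ 1 := by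
  induction n with
  | zero =>
    rw [sum_codeWeight]
    have h1 : codeCount U ≤ U.card := by
      unfold codeCount
      have : ∀ M : Finset (Word 1), IsCode 1 M → ∃ p, M = {p} := fun M hM =>
        Finset.card_eq_one.1 (by simpa using hM.card_eq)
      choose! p hp using this
      refine Finset.card_le_card_of_injOn p ?_ ?_
      · intro M hM
        simp only [coe_filter, mem_univ, true_and, Set.mem_ofPred_eq] at hM
        have h2 := hM.2
        rw [hp M hM.1] at h2
        simpa using h2
      · intro M hM M' hM' h
        simp only [coe_filter, mem_univ, true_and, Set.mem_ofPred_eq] at hM hM'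
        rw [hp M hM.1, hp M' hM'.1, h]
    -- This is `k ≤ 2 ^ (k - 1)` for `k = U.card`; the exponent is real, so `k = 0` is treated
    -- apart.
    have h2 : (codeCount U : ℝ) ≤ (2 : ℝ) ^ ((U.card : ℝ) - 1) := by
      have h3 : (U.card : ℝ) + 1 ≤ 2 ^ U.card := by
        exact_mod_cast Nat.lt_two_pow_self
      rcases Nat.eq_zero_or_pos U.card with h0 | h0
      · have : codeCount U = 0 := by omega
        rw [this]
        simp only [Nat.cast_zero]
        positivity
      · have : (U.card : ℝ) - 1 = ((U.card - 1 : ℕ) : ℝ) := by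
          rw [Nat.cast_sub h0]; simp
        rw [this, Real.rpow_natCast]
        have h4 : U.card - 1 < 2 ^ (U.card - 1) := Nat.lt_two_pow_self
        have h5 : codeCount U ≤ 2 ^ (U.card - 1) := by omega
        exact_mod_cast h5
    simp only [pow_zero, div_one]
    rw [Real.rpow_neg (by norm_num)]
    exact mul_inv_le_one_of_le₀ h2 (by positivity)
  | succ n ih =>
    set S := univ.filter fun M : Finset (Word (n + 2)) => IsCode (n + 2) M ∧ M ⊆ U with hS
    set W : Equiv.Perm (Fin 4) → Finset (Word (n + 2)) → ℝ := fun σ M =>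
      codeWeight (layer U (σ 0)) (layer M (σ 0)) *
      (codeWeight (layer U (σ 1) \ layer M (σ 0)) (layer M (σ 1)) *
      (codeWeight (layer U (σ 2) \ (layer M (σ 0) ∪ layer M (σ 1))) (layer M (σ 2)) *
      codeWeight (layer U (σ 3) \ (layer M (σ 0) ∪ layer M (σ 1) ∪ layer M (σ 2)))
        (layer M (σ 3)))) with hW
    have hW1 : ∀ σ, ∑ M ∈ S, W σ M ≤ 1 := fun σ =>
      sum_codeWeight_layers_le_one ih (fun a => layer U a) σ S
    have key : ∀ M ∈ S, codeWeight U M ≤ (W 1 M + W Fin.revPerm M) / 2 := by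
      intro M hM
      simp only [hS, mem_filter, mem_univ, true_and] at hM
      obtain ⟨hc, hU⟩ := hM
      have hd : ∀ {a b : Fin 4}, a ≠ b → Disjoint (layer M a) (layer M b) :=
        fun h => hc.disjoint_layer h
      have hcov := hc.existsUnique_mem_layer
      have c01 := hd (show (0 : Fin 4) ≠ 1 by decide)
      have c02 := hd (show (0 : Fin 4) ≠ 2 by decide)
      have c03 := hd (show (0 : Fin 4) ≠ 3 by decide)
      have c12 := hd (show (1 : Fin 4) ≠ 2 by decide)
      have c13 := hd (show (1 : Fin 4) ≠ 3 by decide)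
      have c23 := hd (show (2 : Fin 4) ≠ 3 by decide)
      have cov : ∀ x, x ∈ layer M 0 ∨ x ∈ layer M 1 ∨ x ∈ layer M 2 ∨ x ∈ layer M 3 := by
        intro x
        obtain ⟨a, ha, -⟩ := hcov x
        fin_cases a
        exacts [Or.inl ha, Or.inr (Or.inl ha), Or.inr (Or.inr (Or.inl ha)),
          Or.inr (Or.inr (Or.inr ha))]
      have sub := fun a => layer_mono hU a
      have cd := fun a => IsCode.card_eq (hc.1 a)
      have w : ∀ a (A : Finset (Word (n + 1))), Disjoint (layer M a) A →
          codeWeight (layer U a \ A) (layer M a) =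
            (2 : ℝ) ^ (-((((layer U a \ A).card : ℝ) - 4 ^ n) / 2 ^ n)) := by
        intro a A hA
        unfold codeWeight
        rw [if_pos ⟨hc.1 a, subset_sdiff.2 ⟨sub a, hA⟩⟩]
      have w0 : ∀ a, codeWeight (layer U a) (layer M a) =
            (2 : ℝ) ^ (-((((layer U a \ ∅).card : ℝ) - 4 ^ n) / 2 ^ n)) := by
        intro a
        simpa using w a ∅ (disjoint_empty_right _)
      have hcard := card_eq_sum_layer U
      rw [Fin.sum_univ_four] at hcard
      have e0 := card_sdiff_add_card_sdiff (layer U 0) (layer M 0) ∅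
        (layer M 3 ∪ layer M 2 ∪ layer M 1) (sub 0) (by simp)
        (by simp [c01, c02, c03]) (by simp)
        (by intro x; have := cov x; simp only [mem_union, notMem_empty]; tauto)
      have e1 := card_sdiff_add_card_sdiff (layer U 1) (layer M 1) (layer M 0)
        (layer M 3 ∪ layer M 2) (sub 1) c01.symm
        (by simp [c12, c13]) (by simp [c02, c03])
        (by intro x; have := cov x; simp only [mem_union]; tauto)
      have e2 := card_sdiff_add_card_sdiff (layer U 2) (layer M 2) (layer M 0 ∪ layer M 1)
        (layer M 3) (sub 2) (by simp [c02.symm, c12.symm])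
        c23 (by simp [c03, c13])
        (by intro x; have := cov x; simp only [mem_union]; tauto)
      have e3 := card_sdiff_add_card_sdiff (layer U 3) (layer M 3)
        (layer M 0 ∪ layer M 1 ∪ layer M 2) ∅ (sub 3)
        (by simp [c03.symm, c13.symm, c23.symm]) (by simp) (by simp)
        (by intro x; have := cov x; simp only [mem_union, notMem_empty]; tauto)
      rw [cd] at e0 e1 e2 e3
      have r0 : (Fin.revPerm (0 : Fin 4)) = 3 := by decide
      have r1 : (Fin.revPerm (1 : Fin 4)) = 2 := by decide
      have r2 : (Fin.revPerm (2 : Fin 4)) = 1 := by decide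
      have r3 : (Fin.revPerm (3 : Fin 4)) = 0 := by decide
      have hW1' : W 1 M = (2 : ℝ) ^ (-((((layer U 0 \ ∅).card : ℝ) - 4 ^ n) / 2 ^ n) +
          (-((((layer U 1 \ layer M 0).card : ℝ) - 4 ^ n) / 2 ^ n) +
          (-((((layer U 2 \ (layer M 0 ∪ layer M 1)).card : ℝ) - 4 ^ n) / 2 ^ n) +
          -((((layer U 3 \ (layer M 0 ∪ layer M 1 ∪ layer M 2)).card : ℝ) - 4 ^ n) / 2 ^ n)))) := by
        simp only [hW, Equiv.Perm.one_apply]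
        rw [w0, w 1 _ c01.symm, w 2 _ (by simp [c02.symm, c12.symm]),
          w 3 _ (by simp [c03.symm, c13.symm, c23.symm])]
        simp only [Real.rpow_add (show (0 : ℝ) < 2 by norm_num)]
      have hW2' : W Fin.revPerm M = (2 : ℝ) ^ (-((((layer U 3 \ ∅).card : ℝ) - 4 ^ n) / 2 ^ n) +
          (-((((layer U 2 \ layer M 3).card : ℝ) - 4 ^ n) / 2 ^ n) +
          (-((((layer U 1 \ (layer M 3 ∪ layer M 2)).card : ℝ) - 4 ^ n) / 2 ^ n) +
          -((((layer U 0 \ (layer M 3 ∪ layer M 2 ∪ layer M 1)).card : ℝ) - 4 ^ n) / 2 ^ n)))) := by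
        simp only [hW, r0, r1, r2, r3]
        rw [w0, w 2 _ c23, w 1 _ (by simp [c12, c13]),
          w 0 _ (by simp [c03, c01, c02])]
        simp only [Real.rpow_add (show (0 : ℝ) < 2 by norm_num)]
      have hM : codeWeight U M = (2 : ℝ) ^ (-(((U.card : ℝ) - 4 ^ (n + 1)) / 2 ^ (n + 1))) := by
        unfold codeWeight
        rw [if_pos ⟨hc, hU⟩]
      -- Over both orders the available cardinalities add up to `U.card + 4 * 4 ^ n`. Subtracting `4
      -- ^ n` eight times leaves `U.card - 4 ^ (n + 1)`, over `2 ^ n`: twice the exponent of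
      -- `codeWeight U M`.
      have hprod : codeWeight U M ^ 2 = W 1 M * W Fin.revPerm M := by
        rw [hM, hW1', hW2', ← Real.rpow_add (by norm_num), ← Real.rpow_natCast,
          ← Real.rpow_mul (by norm_num)]
        congr 1
        have q0 : ((layer U 0 \ ∅).card : ℝ) + ((layer U 0 \ (layer M 3 ∪ layer M 2 ∪
          layer M 1)).card : ℝ) = (layer U 0).card + 4 ^ n := by exact_mod_cast e0
        have q1 : ((layer U 1 \ layer M 0).card : ℝ) + ((layer U 1 \ (layer M 3 ∪
          layer M 2)).card : ℝ) = (layer U 1).card + 4 ^ n := by exact_mod_cast e1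
        have q2 : ((layer U 2 \ (layer M 0 ∪ layer M 1)).card : ℝ) +
          ((layer U 2 \ layer M 3).card : ℝ) = (layer U 2).card + 4 ^ n := by exact_mod_cast e2
        have q3 : ((layer U 3 \ (layer M 0 ∪ layer M 1 ∪ layer M 2)).card : ℝ) +
          ((layer U 3 \ ∅).card : ℝ) = (layer U 3).card + 4 ^ n := by exact_mod_cast e3
        have q : (U.card : ℝ) = (layer U 0).card + (layer U 1).card + (layer U 2).card +
          (layer U 3).card := by exact_mod_cast hcard
        have h2 : (2 : ℝ) ^ n ≠ 0 := by positivity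
        rw [pow_succ, pow_succ]
        field_simp
        push_cast
        linarith
      have p1 : 0 < W 1 M := by rw [hW1']; positivity
      have p2 : 0 < W Fin.revPerm M := by rw [hW2']; positivity
      nlinarith [sq_nonneg (W 1 M - W Fin.revPerm M)]
    have h0 : ∑ P, codeWeight U P = ∑ P ∈ S, codeWeight U P := by
      rw [hS, Finset.sum_filter]
      refine sum_congr rfl fun P _ => ?_
      unfold codeWeight
      split_ifs <;> rfl
    rw [h0]
    calc ∑ P ∈ S, codeWeight U P ≤ ∑ P ∈ S, (W 1 P + W Fin.revPerm P) / 2 := sum_le_sum key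
      _ = (∑ P ∈ S, W 1 P + ∑ P ∈ S, W Fin.revPerm P) / 2 := by
        rw [← Finset.sum_div, Finset.sum_add_distrib]
      _ ≤ 1 := by linarith [hW1 1, hW1 Fin.revPerm]

/-- An upper bound of Linial–Luria type for the number of codes contained in a set. -/
theorem codeCount_le {n : ℕ} (U : Finset (Word (n + 1))) :
    (codeCount U : ℝ) ≤ 2 ^ (((U.card : ℝ) - 4 ^ n) / 2 ^ n) := by
  have h := sum_codeWeight_le_one n U
  rw [sum_codeWeight, Real.rpow_neg (by norm_num)] at h
  have hp : (0 : ℝ) < 2 ^ (((U.card : ℝ) - 4 ^ n) / 2 ^ n) := by positivity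
  rwa [← div_eq_mul_inv, div_le_one hp] at h

/-- The exponents add up to a quantity depending only on the size of the whole space. It is the
target exponent for length `n + 2`: the layers of such a code form two pairs, in a set and in its
complement, and within each pair one layer determines the other. -/
theorem codeCount_mul_codeCount_compl_le {n : ℕ} (U : Finset (Word (n + 1))) :
    (codeCount U : ℝ) * codeCount Uᶜ ≤ 2 ^ ((2 : ℝ) ^ (n + 1)) := by
  refine (mul_le_mul (codeCount_le U) (codeCount_le Uᶜ) (by positivity) (by positivity)).trans
    (le_of_eq ?_)
  rw [← Real.rpow_add (by norm_num)]
  congr 1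
  have h : (U.card : ℝ) + (Uᶜ.card : ℝ) = 4 ^ (n + 1) := by
    have := Finset.card_add_card_compl U
    rw [card_word] at this
    exact_mod_cast this
  have h4 : (4 : ℝ) ^ n = 2 ^ n * 2 ^ n := by rw [← mul_pow]; norm_num
  have h2 : (2 : ℝ) ^ n ≠ 0 := by positivity
  field_simp
  rw [pow_succ] at h ⊢
  rw [h4] at h ⊢
  linarith

theorem card_isCode_le {n : ℕ} :
    ((univ.filter (IsCode (n + 1))).card : ℝ) ≤ 2 ^ (3 * (2 : ℝ) ^ n) := by
  have h := codeCount_le (univ : Finset (Word (n + 1)))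
  unfold codeCount at h
  simp only [subset_univ, and_true, Finset.card_univ, card_word] at h
  refine h.trans (le_of_eq ?_)
  congr 1
  have h4 : (4 : ℝ) ^ n = 2 ^ n * 2 ^ n := by rw [← mul_pow]; norm_num
  have h2 : (2 : ℝ) ^ n ≠ 0 := by positivity
  push_cast
  field_simp
  rw [pow_succ, h4]
  ring

/-! ### Double-codes and their unions of components -/

theorem mem_layer {n : ℕ} {M : Finset (Word (n + 1))} {a : Fin 4} {x : Word n} :
    x ∈ layer M a ↔ Word.cons a x ∈ M := by simp [layer]

theorem mem_fiber {n : ℕ} {M : Finset (Word (n + 1))} {a : Fin 4} {x : Word n} :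
    a ∈ fiber M x ↔ Word.cons a x ∈ M := by simp [fiber]

theorem layer_union {n : ℕ} (K L : Finset (Word (n + 1))) (a : Fin 4) :
    layer (K ∪ L) a = layer K a ∪ layer L a := by
  ext x; simp [mem_layer]

theorem fiber_union {n : ℕ} (K L : Finset (Word (n + 1))) (x : Word n) :
    fiber (K ∪ L) x = fiber K x ∪ fiber L x := by
  ext a; simp [mem_fiber]

theorem layer_inter {n : ℕ} (K L : Finset (Word (n + 1))) (a : Fin 4) :
    layer (K ∩ L) a = layer K a ∩ layer L a := by
  ext x; simp [mem_layer]

theorem fiber_inter {n : ℕ} (K L : Finset (Word (n + 1))) (x : Word n) :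
    fiber (K ∩ L) x = fiber K x ∩ fiber L x := by
  ext a; simp [mem_fiber]

theorem layer_sdiff {n : ℕ} (K L : Finset (Word (n + 1))) (a : Fin 4) :
    layer (K \ L) a = layer K a \ layer L a := by
  ext x; simp [mem_layer]

theorem fiber_sdiff {n : ℕ} (K L : Finset (Word (n + 1))) (x : Word n) :
    fiber (K \ L) x = fiber K x \ fiber L x := by
  ext a; simp [mem_fiber]

theorem layer_disjoint {n : ℕ} {K L : Finset (Word (n + 1))} (h : Disjoint K L) (a : Fin 4) :
    Disjoint (layer K a) (layer L a) := by
  rw [Finset.disjoint_left] at h ⊢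
  exact fun x hx hx' => h (mem_layer.1 hx) (mem_layer.1 hx')

theorem fiber_disjoint {n : ℕ} {K L : Finset (Word (n + 1))} (h : Disjoint K L) (x : Word n) :
    Disjoint (fiber K x) (fiber L x) := by
  rw [Finset.disjoint_left] at h ⊢
  exact fun a hx hx' => h (mem_fiber.1 hx) (mem_fiber.1 hx')

theorem IsCode.isDouble_union {n : ℕ} {P Q : Finset (Word n)} (hP : IsCode n P) (hQ : IsCode n Q)
    (h : Disjoint P Q) : IsDouble n (P ∪ Q) := by
  induction n with
  | zero => trivial
  | succ n ih =>
    refine ⟨fun a => ?_, fun x => ?_⟩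
    · rw [layer_union]
      exact ih (hP.1 a) (hQ.1 a) (layer_disjoint h a)
    · have h1 : (fiber P x).card = 1 := hP.2 x
      have h2 : (fiber Q x).card = 1 := hQ.2 x
      rw [fiber_union, card_union_of_disjoint (fiber_disjoint h x), h1, h2]

theorem IsDouble.isEmptyOrPair {n : ℕ} {C : Finset (Word n)} (h : IsDouble n C) :
    IsEmptyOrPair n C := by
  induction n with
  | zero => trivial
  | succ n ih => exact ⟨fun a => ih (h.1 a), fun x => Or.inr (h.2 x)⟩

theorem IsEmptyOrPair.sdiff {n : ℕ} {D K : Finset (Word n)} (hD : IsEmptyOrPair n D)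
    (hK : IsEmptyOrPair n K) (h : K ⊆ D) : IsEmptyOrPair n (D \ K) := by
  induction n with
  | zero => trivial
  | succ n ih =>
    refine ⟨fun a => ?_, fun x => ?_⟩
    · rw [layer_sdiff]
      exact ih (hD.1 a) (hK.1 a) (layer_mono h a)
    · have h1 := hD.2 x
      have h2 := hK.2 x
      simp only [fiber_sdiff, card_sdiff_of_subset (fiber_mono h x)] at *
      omega

/-- On each line such a subset of `D` is empty or all of `D`. These subsets form a Boolean algebra,
whose atoms play the role of connected components. -/
theorem IsEmptyOrPair.inter {n : ℕ} {D K L : Finset (Word n)} (hD : IsEmptyOrPair n D)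
    (hK : IsEmptyOrPair n K) (hL : IsEmptyOrPair n L) (hKD : K ⊆ D) (hLD : L ⊆ D) :
    IsEmptyOrPair n (K ∩ L) := by
  induction n with
  | zero => trivial
  | succ n ih =>
    refine ⟨fun a => ?_, fun x => ?_⟩
    · rw [layer_inter]
      exact ih (hD.1 a) (hK.1 a) (hL.1 a) (layer_mono hKD a) (layer_mono hLD a)
    · have h1 := hD.2 x
      have h2 := hK.2 x
      have h3 := hL.2 x
      simp only [fiber_inter] at *
      rcases h2 with h2 | h2
      · left
        rw [card_eq_zero] at h2
        simp [h2]
      · rcases h3 with h3 | h3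
        · left
          rw [card_eq_zero] at h3
          simp [h3]
        · have k1 := card_le_card (fiber_mono hKD x)
          have e1 := eq_of_subset_of_card_le (fiber_mono hKD x) (by omega)
          have e2 := eq_of_subset_of_card_le (fiber_mono hLD x) (by omega)
          rw [e1, e2, inter_self]
          exact h1

/-- On each line two codes agree or differ in two points. Relative to a fixed code in a double-code,
any other code there is thus encoded by a union of components. -/
theorem IsDouble.isEmptyOrPair_symmDiff {n : ℕ} {C P Q : Finset (Word n)} (hC : IsDouble n C)
    (hP : IsCode n P) (hQ : IsCode n Q) (hPC : P ⊆ C) (hQC : Q ⊆ C) :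
    IsEmptyOrPair n (P \ Q ∪ Q \ P) := by
  induction n with
  | zero => trivial
  | succ n ih =>
    refine ⟨fun a => ?_, fun x => ?_⟩
    · rw [layer_union, layer_sdiff, layer_sdiff]
      exact ih (hC.1 a) (hP.1 a) (hQ.1 a) (layer_mono hPC a) (layer_mono hQC a)
    · obtain ⟨a, ha⟩ := card_eq_one.1 (hP.2 x)
      obtain ⟨b, hb⟩ := card_eq_one.1 (hQ.2 x)
      rw [fiber_union, fiber_sdiff, fiber_sdiff, ha, hb]
      by_cases hab : a = b
      · left; simp [hab]
      · right
        rw [sdiff_eq_self_of_disjoint (by simpa using hab),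
          sdiff_eq_self_of_disjoint (by simpa using Ne.symm hab),
          card_union_of_disjoint (by simpa using hab)]
        simp

theorem IsEmptyOrPair.exists_two_layers {n : ℕ} {K : Finset (Word (n + 1))}
    (h : IsEmptyOrPair (n + 1) K) (hK : K.Nonempty) :
    ∃ a b x, a ≠ b ∧ x ∈ layer K a ∧ x ∈ layer K b := by
  obtain ⟨a, x, hx⟩ := layer_nonempty hK
  have ha : a ∈ fiber K x := mem_fiber_iff_mem_layer.2 hx
  have h2 : (fiber K x).card = 2 := (h.2 x).resolve_left (card_ne_zero_of_mem ha)
  obtain ⟨b, hb, hba⟩ := exists_mem_ne (by omega : 1 < (fiber K x).card) a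
  exact ⟨a, b, x, hba.symm, hx, mem_fiber_iff_mem_layer.1 hb⟩

/-- A line meeting `K` contains a second point of it, so at least two layers are nonempty and the
bound doubles with each letter. -/
theorem IsEmptyOrPair.two_pow_le_card {n : ℕ} {K : Finset (Word n)} (h : IsEmptyOrPair n K)
    (hK : K.Nonempty) : 2 ^ n ≤ K.card := by
  induction n with
  | zero => simpa using hK
  | succ n ih =>
    obtain ⟨a, b, x, hab, ha, hb⟩ := h.exists_two_layers hK
    have h1 := ih (h.1 a) ⟨x, ha⟩
    have h2 := ih (h.1 b) ⟨x, hb⟩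
    have h3 : ∑ c ∈ {a, b}, (layer K c).card ≤ ∑ c, (layer K c).card :=
      sum_le_sum_of_subset (subset_univ _)
    rw [← card_eq_sum_layer, sum_pair hab] at h3
    rw [pow_succ]
    omega

theorem fiber_eq_of_agree (A B : Finset (Fin 4)) (a : Fin 4) (hA : A.card % 2 = 0)
    (hB : B.card % 2 = 0) (h : ∀ b, b ≠ a → (b ∈ A ↔ b ∈ B)) : A = B := by
  revert A B a
  decide

/-- Every line meets the set in an even number of points, so three layers determine the fourth by
parity. -/
theorem IsEmptyOrPair.ext_of_layers {n : ℕ} {K L : Finset (Word (n + 1))}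
    (hK : IsEmptyOrPair (n + 1) K) (hL : IsEmptyOrPair (n + 1) L) (a : Fin 4)
    (h : ∀ b, b ≠ a → layer K b = layer L b) : K = L := by
  refine ext_layer fun c => ?_
  ext x
  rw [← mem_fiber_iff_mem_layer, ← mem_fiber_iff_mem_layer]
  have : fiber K x = fiber L x := by
    refine fiber_eq_of_agree _ _ a ?_ ?_ fun b hb => ?_
    · rcases hK.2 x with h | h <;> rw [h]
    · rcases hL.2 x with h | h <;> rw [h]
    · rw [mem_fiber_iff_mem_layer, mem_fiber_iff_mem_layer, h b hb]
  rw [this]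

theorem mem_iff_notMem_of_card_two (A : Finset (Fin 4)) (a b c : Fin 4) (hA : A.card = 2)
    (hab : a ≠ b) (hca : c ≠ a) (hcb : c ≠ b) (h : a ∈ A ↔ b ∈ A) : c ∈ A ↔ a ∉ A := by
  revert A a b c
  decide

theorem exists_fourth (a b c : Fin 4) : ∃ d, d ≠ a ∧ d ≠ b ∧ d ≠ c := by
  revert a b c
  decide

theorem eq_add_of_ne (a b : Fin 4) (h : b ≠ a) : b = a + 1 ∨ b = a + 2 ∨ b = a + 3 := by
  revert a b
  decide

theorem eq_fourth (a b c d e : Fin 4) (hab : a ≠ b) (hca : c ≠ a) (hcb : c ≠ b) (hda : d ≠ a)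
    (hdb : d ≠ b) (hdc : d ≠ c) (he : e ≠ d) : e = a ∨ e = b ∨ e = c := by
  omega

/-- A double-code is determined by any nonempty union of its connected components. -/
theorem IsDouble.eq_of_common_subset {n : ℕ} {C C' K : Finset (Word n)} (hC : IsDouble n C)
    (hC' : IsDouble n C') (hK : IsEmptyOrPair n K) (hne : K.Nonempty) (h : K ⊆ C) (h' : K ⊆ C') :
    C = C' := by
  induction n with
  | zero =>
    obtain ⟨x, hx⟩ := hne
    ext ⟨⟩
    exact ⟨fun _ => h' hx, fun _ => h hx⟩
  | succ n ih =>
    obtain ⟨a, b, x, hab, ha, hb⟩ := hK.exists_two_layers hne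
    have agree : ∀ c, (layer K c).Nonempty → layer C c = layer C' c := fun c hc =>
      ih (hC.1 c) (hC'.1 c) (hK.1 c) hc (layer_mono h c) (layer_mono h' c)
    -- If `K` meets three layers, induction settles those layers of `C` and `C'`, and parity
    -- supplies the fourth.
    by_cases hc : ∃ c, c ≠ a ∧ c ≠ b ∧ (layer K c).Nonempty
    · obtain ⟨c, hca, hcb, hc⟩ := hc
      obtain ⟨d, hda, hdb, hdc⟩ : ∃ d, d ≠ a ∧ d ≠ b ∧ d ≠ c := by
        exact exists_fourth a b c
      refine hC.isEmptyOrPair.ext_of_layers hC'.isEmptyOrPair d fun e he => ?_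
      rcases eq_fourth a b c d e hab hca hcb hda hdb hdc he with rfl | rfl | rfl
      exacts [agree _ ⟨x, ha⟩, agree _ ⟨x, hb⟩, agree _ hc]
    -- Otherwise `K` lives in layers `a` and `b`, which then coincide. So layers `a` and `b` of `C`
    -- share `layer K a` and are equal by induction; the two remaining layers are their complement.
    -- The same holds for `C'`.
    · push Not at hc
      have hKab : layer K a = layer K b := by
        have key : ∀ a b : Fin 4, a ≠ b → (∀ c, c ≠ a → c ≠ b → layer K c = ∅) →
            layer K a ⊆ layer K b := by
          intro a b hab hc y hy
          have hy' : a ∈ fiber K y := mem_fiber_iff_mem_layer.2 hy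
          have h2 : (fiber K y).card = 2 := (hK.2 y).resolve_left (card_ne_zero_of_mem hy')
          obtain ⟨e, he, hea⟩ := exists_mem_ne (by omega : 1 < (fiber K y).card) a
          rw [mem_fiber_iff_mem_layer] at he
          by_cases heb : e = b
          · rwa [heb] at he
          · rw [hc e hea heb] at he
            simp at he
        exact (key a b hab hc).antisymm (key b a hab.symm fun c h1 h2 => hc c h2 h1)
      have eqC : layer C a = layer C b := ih (hC.1 a) (hC.1 b) (hK.1 a) ⟨x, ha⟩ (layer_mono h a)
        (hKab ▸ layer_mono h b)
      have eqC' : layer C' a = layer C' b := ih (hC'.1 a) (hC'.1 b) (hK.1 a) ⟨x, ha⟩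
        (layer_mono h' a) (hKab ▸ layer_mono h' b)
      have ea := agree a ⟨x, ha⟩
      refine ext_layer fun c => ?_
      by_cases hca : c = a
      · rw [hca, ea]
      by_cases hcb : c = b
      · rw [hcb, agree b ⟨x, hb⟩]
      ext y
      have k1 := mem_iff_notMem_of_card_two (fiber C y) a b c (hC.2 y) hab hca hcb
        (by rw [mem_fiber_iff_mem_layer, mem_fiber_iff_mem_layer, eqC])
      have k2 := mem_iff_notMem_of_card_two (fiber C' y) a b c (hC'.2 y) hab hca hcb
        (by rw [mem_fiber_iff_mem_layer, mem_fiber_iff_mem_layer, eqC'])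
      simp only [mem_fiber_iff_mem_layer] at k1 k2
      rw [k1, k2, ea]

/-- Split off a minimal nonempty `K`. Every `L` contains or misses it, so a split costs a factor 2
and removes at least `B` points. -/
theorem card_isEmptyOrPair_subsets_le {n : ℕ} {B : ℝ} (hB : 0 < B) (D : Finset (Word n))
    (hD : IsEmptyOrPair n D)
    (h : ∀ K ⊆ D, IsEmptyOrPair n K → K.Nonempty → B ≤ K.card) :
    ((univ.filter fun L : Finset (Word n) => IsEmptyOrPair n L ∧ L ⊆ D).card : ℝ) ≤
      2 ^ ((D.card : ℝ) / B) := by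
  induction D using Finset.strongInduction with
  | H D ih =>
    rcases D.eq_empty_or_nonempty with rfl | hne
    · have : (univ.filter fun L : Finset (Word n) => IsEmptyOrPair n L ∧ L ⊆ ∅) ⊆ {∅} := by
        intro L hL
        simp only [mem_filter, subset_empty] at hL
        simp [hL.2.2]
      have := card_le_card this
      simp only [card_singleton] at this
      simpa using this
    · obtain ⟨K, hK, hmin⟩ := exists_min_image
        (univ.filter fun K : Finset (Word n) => IsEmptyOrPair n K ∧ K ⊆ D ∧ K.Nonempty) card
        ⟨D, by simp [hD, hne]⟩
      simp only [mem_filter, mem_univ, true_and] at hK hmin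
      obtain ⟨hK, hKD, hKne⟩ := hK
      have hss : D \ K ⊂ D := sdiff_ssubset hKD hKne
      have hrec := ih (D \ K) hss (hD.sdiff hK hKD) fun L hL => h L (hL.trans sdiff_subset)
      have hcount : (univ.filter fun L : Finset (Word n) => IsEmptyOrPair n L ∧ L ⊆ D).card ≤
          ((univ : Finset Bool) ×ˢ
            (univ.filter fun L : Finset (Word n) => IsEmptyOrPair n L ∧ L ⊆ D \ K)).card := by
        refine card_le_card_of_injOn (fun L => (decide (L ∩ K = ∅), L \ K)) ?_ ?_
        · intro L hL
          simp only [coe_filter, mem_univ, true_and, Set.mem_ofPred_eq] at hL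
          simp only [coe_product, coe_univ, coe_filter, mem_univ, true_and, Set.mem_prod,
            Set.mem_univ, Set.mem_ofPred_eq]
          refine ⟨?_, sdiff_subset_sdiff hL.2 le_rfl⟩
          have := hL.1.sdiff (hD.inter hL.1 hK hL.2 hKD) inter_subset_left
          rwa [sdiff_inter_self_left] at this
        · have alt : ∀ L, IsEmptyOrPair n L → L ⊆ D → L ∩ K = ∅ ∨ L ∩ K = K := by
            intro L hL hLD
            rcases (L ∩ K).eq_empty_or_nonempty with h0 | h0
            · exact Or.inl h0
            · exact Or.inr (eq_of_subset_of_card_le inter_subset_right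
                (hmin _ ⟨hD.inter hL hK hLD hKD, inter_subset_left.trans hLD, h0⟩))
          intro L hL L' hL' he
          simp only [coe_filter, mem_univ, true_and, Set.mem_ofPred_eq] at hL hL'
          simp only [Prod.mk.injEq, decide_eq_decide] at he
          have : L ∩ K = L' ∩ K := by
            rcases alt L hL.1 hL.2 with h1 | h1
            · rw [h1, he.1.1 h1]
            · rcases alt L' hL'.1 hL'.2 with h2 | h2
              · rw [h2, he.1.2 h2]
              · rw [h1, h2]
          rw [← sdiff_union_inter L K, ← sdiff_union_inter L' K, he.2, this]
      rw [card_product, card_univ, Fintype.card_bool] at hcount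
      have hcount' : ((univ.filter fun L : Finset (Word n) =>
          IsEmptyOrPair n L ∧ L ⊆ D).card : ℝ) ≤ 2 * ((univ.filter fun L : Finset (Word n) =>
          IsEmptyOrPair n L ∧ L ⊆ D \ K).card : ℝ) := by exact_mod_cast hcount
      refine hcount'.trans ((mul_le_mul_of_nonneg_left hrec (by norm_num)).trans ?_)
      rw [← Real.rpow_one_add' (by norm_num) (by positivity)]
      refine Real.rpow_le_rpow_of_exponent_le (by norm_num) ?_
      have hB' := h K hKD hK hKne
      have hc : ((D \ K).card : ℝ) = D.card - K.card := by
        rw [card_sdiff_of_subset hKD, Nat.cast_sub (card_le_card hKD)]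
      rw [hc, sub_div]
      have : 1 ≤ (K.card : ℝ) / B := (one_le_div hB).2 hB'
      linarith

/-! ### Few small sets meet every line in 0 or 2 points -/

/-- Weights of sets meeting each line in `0` or `2` points, with total mass at most two. -/
def pairWeight {n : ℕ} (K : Finset (Word n)) : ℝ :=
  2 ^ (-(5 * n * ((K.card : ℝ) / 2 ^ n) ^ 2))

/-- Induction, dropping a largest layer: the other three determine `K`, and their normalised squared
sizes add up to at most that of `K`. Passing from `5 * n` to `5 * (n + 1)` yields the factor `1 /
32`, as a nonempty `K` has normalised size at least one. Three layer sums of at most 2 (empty layer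
included) and four choices of dropped layer give `4 * 8 / 32 = 1`. -/
theorem sum_pairWeight_le_one (n : ℕ) :
    ∑ K : Finset (Word n) with IsEmptyOrPair n K ∧ K.Nonempty, pairWeight K ≤ 1 := by
  induction n with
  | zero =>
    have : ∀ K : Finset (Word 0), pairWeight K = 1 := by intro K; simp [pairWeight]
    simp only [this, sum_const, nsmul_eq_mul, mul_one]
    have : (univ.filter fun K : Finset (Word 0) => IsEmptyOrPair 0 K ∧ K.Nonempty) ⊆ {univ} := by
      intro K hK
      simp only [mem_filter] at hK
      obtain ⟨x, hx⟩ := hK.2.2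
      rw [mem_singleton]
      ext ⟨⟩
      exact ⟨fun _ => mem_univ _, fun _ => hx⟩
    exact_mod_cast card_le_card this
  | succ n ih =>
    have ih2 : ∑ K : Finset (Word n) with IsEmptyOrPair n K, pairWeight K ≤ 2 := by
      have : (univ.filter fun K : Finset (Word n) => IsEmptyOrPair n K) ⊆
          insert ∅ (univ.filter fun K : Finset (Word n) => IsEmptyOrPair n K ∧ K.Nonempty) := by
        intro K hK
        simp only [mem_filter, mem_univ, true_and, mem_insert] at hK ⊢
        rcases K.eq_empty_or_nonempty with h | h
        · exact Or.inl h
        · exact Or.inr ⟨hK, h⟩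
      refine (sum_le_sum_of_subset_of_nonneg this fun K _ _ => ?_).trans ?_
      · unfold pairWeight; positivity
      · rw [sum_insert (by simp)]
        have : pairWeight (∅ : Finset (Word n)) = 1 := by simp [pairWeight]
        linarith
    set T := univ.filter fun K : Finset (Word (n + 1)) =>
      IsEmptyOrPair (n + 1) K ∧ K.Nonempty with hT
    set R := univ.filter fun K : Finset (Word n) => IsEmptyOrPair n K with hR
    set T' : Fin 4 → Finset (Finset (Word (n + 1))) := fun a =>
      T.filter fun K => ∀ b, (layer K b).card ≤ (layer K a).card with hT'
    have hcover : ∀ K : Finset (Word (n + 1)), ∃ a, ∀ b, (layer K b).card ≤ (layer K a).card := by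
      intro K
      obtain ⟨a, -, ha⟩ := exists_max_image (univ : Finset (Fin 4))
        (fun a => (layer K a).card) univ_nonempty
      exact ⟨a, fun b => ha b (mem_univ _)⟩
    have bound : ∀ a, ∑ K ∈ T' a, pairWeight K ≤ 1 / 4 := by
      intro a
      have hpt : ∀ K ∈ T' a, pairWeight K ≤ (1 / 32) * (pairWeight (layer K (a + 1)) *
          pairWeight (layer K (a + 2)) * pairWeight (layer K (a + 3))) := by
        intro K hK
        simp only [hT', hT, mem_filter, mem_univ, true_and] at hK
        obtain ⟨⟨hK, hne⟩, hmax⟩ := hK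
        have hge : (1 : ℝ) ≤ K.card / 2 ^ (n + 1) := by
          rw [one_le_div (by positivity)]
          exact_mod_cast hK.two_pow_le_card hne
        have hsum : (K.card : ℝ) = (layer K a).card + (layer K (a + 1)).card +
            (layer K (a + 2)).card + (layer K (a + 3)).card := by
          have h1 : K.card = (layer K a).card + (layer K (a + 1)).card +
            (layer K (a + 2)).card + (layer K (a + 3)).card := by
            rw [card_eq_sum_layer, Fin.sum_univ_four]
            fin_cases a <;> simp <;> ring
          exact_mod_cast h1
        have m1 : ((layer K (a + 1)).card : ℝ) ≤ (layer K a).card := by exact_mod_cast hmax _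
        have m2 : ((layer K (a + 2)).card : ℝ) ≤ (layer K a).card := by exact_mod_cast hmax _
        have m3 : ((layer K (a + 3)).card : ℝ) ≤ (layer K a).card := by exact_mod_cast hmax _
        have n1 : (0 : ℝ) ≤ (layer K (a + 1)).card := by positivity
        have n2 : (0 : ℝ) ≤ (layer K (a + 2)).card := by positivity
        have n3 : (0 : ℝ) ≤ (layer K (a + 3)).card := by positivity
        have h32 : (1 / 32 : ℝ) = 2 ^ (-5 : ℝ) := by
          rw [Real.rpow_neg (by norm_num)]; norm_num
        unfold pairWeight
        rw [h32, ← Real.rpow_add (by norm_num), ← Real.rpow_add (by norm_num),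
          ← Real.rpow_add (by norm_num)]
        refine Real.rpow_le_rpow_of_exponent_le (by norm_num) ?_
        generalize ((layer K (a + 1)).card : ℝ) = x at *
        generalize ((layer K (a + 2)).card : ℝ) = y at *
        generalize ((layer K (a + 3)).card : ℝ) = z at *
        generalize ((layer K a).card : ℝ) = w at *
        -- Uses `w * x ≥ x ^ 2` and its analogues. Equality holds for two equal layers and two empty
        -- ones, which matches the normalisation by `2 ^ n`.
        have hq : 4 * (x ^ 2 + y ^ 2 + z ^ 2) ≤ (K.card : ℝ) ^ 2 := by
          rw [hsum]
          have k1 := mul_nonneg n1 (sub_nonneg.2 m1)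
          have k2 := mul_nonneg n2 (sub_nonneg.2 m2)
          have k3 := mul_nonneg n3 (sub_nonneg.2 m3)
          have k4 : 0 ≤ w ^ 2 + 2 * (x * y + x * z + y * z) - (x ^ 2 + y ^ 2 + z ^ 2) := by
            rcases le_total x y with h1 | h1 <;> rcases le_total y z with h2 | h2 <;>
              rcases le_total x z with h3 | h3 <;> nlinarith
          nlinarith
        have hq' : (x / 2 ^ n) ^ 2 + (y / 2 ^ n) ^ 2 + (z / 2 ^ n) ^ 2 ≤
            ((K.card : ℝ) / 2 ^ (n + 1)) ^ 2 := by
          have h2 : (0 : ℝ) < 2 ^ n := by positivity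
          rw [pow_succ 2 n, div_pow, div_pow, div_pow, div_pow, mul_pow, ← add_div, ← add_div,
            div_le_div_iff₀ (by positivity) (by positivity)]
          nlinarith [mul_le_mul_of_nonneg_right hq (by positivity : (0 : ℝ) ≤ (2 ^ n) ^ 2)]
        have hn : (0 : ℝ) ≤ n := by positivity
        have := mul_le_mul_of_nonneg_left hq' (by positivity : (0 : ℝ) ≤ 5 * n)
        push_cast
        nlinarith
      have hnn : ∀ K : Finset (Word n), 0 ≤ pairWeight K := fun K => by
        unfold pairWeight; positivity
      have hinj : Set.InjOn (fun K : Finset (Word (n + 1)) =>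
          (layer K (a + 1), layer K (a + 2), layer K (a + 3))) (T' a) := by
        intro K hK L hL h
        simp only [hT', hT, coe_filter, mem_filter, mem_univ, true_and, Set.mem_ofPred_eq]
          at hK hL
        simp only [Prod.mk.injEq] at h
        refine hK.1.1.ext_of_layers hL.1.1 a fun b hb => ?_
        have : b = a + 1 ∨ b = a + 2 ∨ b = a + 3 :=
          eq_add_of_ne a b hb
        rcases this with rfl | rfl | rfl
        exacts [h.1, h.2.1, h.2.2]
      calc ∑ K ∈ T' a, pairWeight K
          ≤ ∑ K ∈ T' a, (1 / 32) * (pairWeight (layer K (a + 1)) *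
          pairWeight (layer K (a + 2)) * pairWeight (layer K (a + 3))) := sum_le_sum hpt
        _ = (1 / 32) * ∑ p ∈ (T' a).image (fun K : Finset (Word (n + 1)) =>
          (layer K (a + 1), layer K (a + 2), layer K (a + 3))),
            pairWeight p.1 * pairWeight p.2.1 * pairWeight p.2.2 := by
          rw [sum_image hinj, mul_sum]
        _ ≤ (1 / 32) * ∑ p ∈ R ×ˢ R ×ˢ R,
            pairWeight p.1 * pairWeight p.2.1 * pairWeight p.2.2 := by
          refine mul_le_mul_of_nonneg_left (sum_le_sum_of_subset_of_nonneg ?_ fun p _ _ => ?_)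
            (by norm_num)
          · intro p hp
            simp only [hT', hT, mem_image, mem_filter, mem_univ, true_and] at hp
            obtain ⟨K, hK, rfl⟩ := hp
            simp only [hR, mem_product, mem_filter, mem_univ, true_and]
            exact ⟨hK.1.1.1 _, hK.1.1.1 _, hK.1.1.1 _⟩
          · exact mul_nonneg (mul_nonneg (hnn _) (hnn _)) (hnn _)
        _ = (1 / 32) * (∑ K ∈ R, pairWeight K) ^ 3 := by
          rw [sum_product]
          simp only [sum_product, ← mul_sum, ← sum_mul]
          ring
        _ ≤ (1 / 32) * 2 ^ 3 := by
          gcongr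
          exact sum_nonneg fun K _ => hnn K
        _ = 1 / 4 := by norm_num
    have hnn : ∀ K : Finset (Word (n + 1)), 0 ≤ pairWeight K := fun K => by
      unfold pairWeight; positivity
    calc ∑ K ∈ T, pairWeight K ≤ ∑ K ∈ T, ∑ a,
          if ∀ b, (layer K b).card ≤ (layer K a).card then pairWeight K else 0 := by
          refine sum_le_sum fun K _ => ?_
          obtain ⟨a, ha⟩ := hcover K
          refine le_trans (by rw [if_pos ha]) (single_le_sum (f := fun a =>
            if ∀ b, (layer K b).card ≤ (layer K a).card then pairWeight K else 0)
            (fun b _ => ?_) (mem_univ a))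
          split_ifs
          exacts [hnn K, le_rfl]
      _ = ∑ a, ∑ K ∈ T' a, pairWeight K := by
          rw [sum_comm]
          exact sum_congr rfl fun a _ => (sum_filter _ _).symm
      _ ≤ ∑ _a : Fin 4, (1 / 4 : ℝ) := sum_le_sum fun a _ => bound a
      _ = 1 := by simp

/-- Markov's inequality: every set counted has `pairWeight` at least `2 ^ (-(5 * n * s ^ 2))`. -/
theorem card_small_isEmptyOrPair_le (n : ℕ) (s : ℝ) :
    ((univ.filter fun K : Finset (Word n) =>
      IsEmptyOrPair n K ∧ K.Nonempty ∧ (K.card : ℝ) ≤ s * 2 ^ n).card : ℝ) ≤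
      2 ^ (5 * n * s ^ 2) := by
  have h1 : ((univ.filter fun K : Finset (Word n) =>
      IsEmptyOrPair n K ∧ K.Nonempty ∧ (K.card : ℝ) ≤ s * 2 ^ n).card : ℝ) *
      2 ^ (-(5 * n * s ^ 2)) ≤ 1 := by
    refine le_trans ?_ (sum_pairWeight_le_one n)
    rw [← nsmul_eq_mul, ← sum_const]
    refine (sum_le_sum fun K hK => ?_).trans (sum_le_sum_of_subset_of_nonneg (f := pairWeight)
      (fun K hK => ?_) fun K _ _ => ?_)
    · simp only [mem_filter, mem_univ, true_and] at hK
      refine Real.rpow_le_rpow_of_exponent_le (by norm_num) (neg_le_neg ?_)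
      have : (K.card : ℝ) / 2 ^ n ≤ s := (div_le_iff₀ (by positivity)).2 hK.2.2
      gcongr
    · simp only [mem_filter, mem_univ, true_and] at hK ⊢
      exact ⟨hK.1, hK.2.1⟩
    · unfold pairWeight; positivity
  rwa [Real.rpow_neg (by norm_num), ← div_eq_mul_inv, div_le_one (by positivity)] at h1

/-! ### Splittable and non-splittable codes -/

/-- The last two layers of `M` contain a small union of components. -/
def IsSplittable {n : ℕ} (s : ℝ) (M : Finset (Word (n + 1))) : Prop :=
  ∃ K, IsEmptyOrPair n K ∧ K.Nonempty ∧ (K.card : ℝ) ≤ s * 2 ^ n ∧ K ⊆ layer M 2 ∪ layer M 3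

theorem IsCode.layer_cover {n : ℕ} {M : Finset (Word (n + 1))} (h : IsCode (n + 1) M)
    (x : Word n) : x ∈ layer M 0 ∨ x ∈ layer M 1 ∨ x ∈ layer M 2 ∨ x ∈ layer M 3 := by
  obtain ⟨a, ha, -⟩ := h.existsUnique_mem_layer x
  fin_cases a
  exacts [Or.inl ha, Or.inr (Or.inl ha), Or.inr (Or.inr (Or.inl ha)),
    Or.inr (Or.inr (Or.inr ha))]

theorem IsCode.compl_union_layer {n : ℕ} {M : Finset (Word (n + 1))} (h : IsCode (n + 1) M) :
    (layer M 0 ∪ layer M 1)ᶜ = layer M 2 ∪ layer M 3 := by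
  ext x
  have h1 := h.layer_cover x
  have h2 : ∀ {a b : Fin 4}, a ≠ b → x ∈ layer M a → x ∉ layer M b := fun hab h1 =>
    Finset.disjoint_left.1 (h.disjoint_layer hab) h1
  have c02 := @h2 0 2 (by decide)
  have c03 := @h2 0 3 (by decide)
  have c12 := @h2 1 2 (by decide)
  have c13 := @h2 1 3 (by decide)
  simp only [mem_compl, mem_union]
  tauto

theorem sdiff_union_left_of_disjoint {α : Type*} {A B : Finset α} (h : Disjoint A B) :
    (A ∪ B) \ A = B := by
  rw [union_sdiff_left, sdiff_eq_self_of_disjoint h.symm]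

theorem IsCode.ext_of_layers {n : ℕ} {M M' : Finset (Word (n + 1))} (h : IsCode (n + 1) M)
    (h' : IsCode (n + 1) M') (hC : layer M 2 ∪ layer M 3 = layer M' 2 ∪ layer M' 3)
    (h0 : layer M 0 = layer M' 0) (h2 : layer M 2 = layer M' 2) : M = M' := by
  have d01 : ∀ {M : Finset (Word (n + 1))}, IsCode (n + 1) M → Disjoint (layer M 0) (layer M 1) :=
    fun h => h.disjoint_layer (by decide)
  have d23 : ∀ {M : Finset (Word (n + 1))}, IsCode (n + 1) M → Disjoint (layer M 2) (layer M 3) :=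
    fun h => h.disjoint_layer (by decide)
  have hC' : layer M 0 ∪ layer M 1 = layer M' 0 ∪ layer M' 1 := by
    rw [← compl_inj_iff, h.compl_union_layer, h'.compl_union_layer, hC]
  have h1 : layer M 1 = layer M' 1 := by
    rw [← sdiff_union_left_of_disjoint (d01 h), ← sdiff_union_left_of_disjoint (d01 h'), hC', h0]
  have h3 : layer M 3 = layer M' 3 := by
    rw [← sdiff_union_left_of_disjoint (d23 h), ← sdiff_union_left_of_disjoint (d23 h'), hC, h2]
  refine ext_layer fun a => ?_
  fin_cases a
  exacts [h0, h1, h2, h3]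

theorem IsCode.isDouble_layers {n : ℕ} {M : Finset (Word (n + 1))} (h : IsCode (n + 1) M) :
    IsDouble n (layer M 2 ∪ layer M 3) :=
  IsCode.isDouble_union (h.1 2) (h.1 3) (h.disjoint_layer (by decide))

/-- By `IsDouble.eq_of_common_subset`, `K` fixes the union of layers 2 and 3, hence its complement
too. One code inside each then determines `M`. -/
theorem card_code_of_subset_le {n : ℕ} {K : Finset (Word (n + 1))}
    (hK : IsEmptyOrPair (n + 1) K) (hne : K.Nonempty) :
    ((univ.filter fun M : Finset (Word (n + 2)) =>
      IsCode (n + 2) M ∧ K ⊆ layer M 2 ∪ layer M 3).card : ℝ) ≤ 2 ^ ((2 : ℝ) ^ (n + 1)) := by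
  rcases (univ.filter fun M : Finset (Word (n + 2)) =>
      IsCode (n + 2) M ∧ K ⊆ layer M 2 ∪ layer M 3).eq_empty_or_nonempty with h0 | ⟨M₀, h0⟩
  · rw [h0]
    simp only [card_empty, Nat.cast_zero]
    positivity
  · simp only [mem_filter, mem_univ, true_and] at h0
    set C := layer M₀ 2 ∪ layer M₀ 3 with hC
    refine le_trans ?_ (codeCount_mul_codeCount_compl_le C)
    unfold codeCount
    rw [← Nat.cast_mul, ← card_product, Nat.cast_le]
    have hCM : ∀ M : Finset (Word (n + 2)), IsCode (n + 2) M → K ⊆ layer M 2 ∪ layer M 3 →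
        layer M 2 ∪ layer M 3 = C := fun M hM hKM =>
      hM.isDouble_layers.eq_of_common_subset h0.1.isDouble_layers hK hne hKM h0.2
    refine card_le_card_of_injOn (fun M => (layer M 2, layer M 0)) ?_ ?_
    · intro M hM
      simp only [coe_filter, mem_univ, true_and, Set.mem_ofPred_eq] at hM
      simp only [coe_product, coe_filter, mem_univ, true_and, Set.mem_prod, Set.mem_ofPred_eq]
      have := hCM M hM.1 hM.2
      refine ⟨⟨hM.1.1 2, this ▸ subset_union_left⟩, hM.1.1 0, ?_⟩
      rw [← this, ← hM.1.compl_union_layer, compl_compl]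
      exact subset_union_left
    · intro M hM M' hM' h
      simp only [coe_filter, mem_univ, true_and, Set.mem_ofPred_eq] at hM hM'
      simp only [Prod.mk.injEq] at h
      exact hM.1.ext_of_layers hM'.1 ((hCM M hM.1 hM.2).trans (hCM M' hM'.1 hM'.2).symm) h.2 h.1

theorem card_isSplittable_le (n : ℕ) (s : ℝ) :
    ((univ.filter fun M : Finset (Word (n + 2)) =>
      IsCode (n + 2) M ∧ IsSplittable s M).card : ℝ) ≤
      2 ^ (5 * ((n + 1 : ℕ) : ℝ) * s ^ 2 + (2 : ℝ) ^ (n + 1)) := by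
  set R := univ.filter fun K : Finset (Word (n + 1)) =>
    IsEmptyOrPair (n + 1) K ∧ K.Nonempty ∧ (K.card : ℝ) ≤ s * 2 ^ (n + 1) with hR
  have hsub : (univ.filter fun M : Finset (Word (n + 2)) =>
      IsCode (n + 2) M ∧ IsSplittable s M) ⊆ R.biUnion fun K =>
      univ.filter fun M : Finset (Word (n + 2)) =>
        IsCode (n + 2) M ∧ K ⊆ layer M 2 ∪ layer M 3 := by
    intro M hM
    simp only [mem_filter, mem_univ, true_and] at hM
    obtain ⟨hM, K, hK, hne, hs, hKM⟩ := hM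
    simp only [mem_biUnion, hR, mem_filter, mem_univ, true_and]
    exact ⟨K, ⟨hK, hne, hs⟩, hM, hKM⟩
  have h1 := (card_le_card hsub).trans card_biUnion_le
  calc _ ≤ ((∑ K ∈ R, (univ.filter fun M : Finset (Word (n + 2)) =>
        IsCode (n + 2) M ∧ K ⊆ layer M 2 ∪ layer M 3).card : ℕ) : ℝ) := Nat.cast_le.2 h1
    _ ≤ ∑ K ∈ R, (2 : ℝ) ^ ((2 : ℝ) ^ (n + 1)) := by
      rw [Nat.cast_sum]
      refine sum_le_sum fun K hK => ?_
      simp only [hR, mem_filter, mem_univ, true_and] at hK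
      exact card_code_of_subset_le hK.1 hK.2.1
    _ ≤ _ := by
      rw [sum_const, nsmul_eq_mul, Real.rpow_add (by norm_num)]
      exact mul_le_mul_of_nonneg_right (card_small_isEmptyOrPair_le (n + 1) s) (by positivity)

/-- Layers 0 and 1 fix the double-code carrying the other two. It has at most `4 ^ n` points and
components of at least `s * 2 ^ n`, which leaves at most `2 ^ n / s` binary choices. -/
theorem card_not_isSplittable_le {n : ℕ} {s : ℝ} (hs : 0 < s) (P Q : Finset (Word n)) :
    ((univ.filter fun M : Finset (Word (n + 1)) =>
      (IsCode (n + 1) M ∧ ¬ IsSplittable s M) ∧ layer M 0 = P ∧ layer M 1 = Q).card : ℝ) ≤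
      2 ^ ((2 : ℝ) ^ n / s) := by
  rcases (univ.filter fun M : Finset (Word (n + 1)) => (IsCode (n + 1) M ∧ ¬ IsSplittable s M) ∧
      layer M 0 = P ∧ layer M 1 = Q).eq_empty_or_nonempty with h0 | ⟨M₀, h0⟩
  · rw [h0]
    simp only [card_empty, Nat.cast_zero]
    positivity
  · simp only [mem_filter, mem_univ, true_and] at h0
    set C := layer M₀ 2 ∪ layer M₀ 3 with hC
    have hCM : ∀ M : Finset (Word (n + 1)), IsCode (n + 1) M → layer M 0 = P → layer M 1 = Q →
        layer M 2 ∪ layer M 3 = C := fun M hM hP hQ => by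
      rw [hC, ← hM.compl_union_layer, ← h0.1.1.compl_union_layer, hP, hQ, h0.2.1, h0.2.2]
    have hdouble : IsDouble n C := h0.1.1.isDouble_layers
    have hcount := card_isEmptyOrPair_subsets_le (B := s * 2 ^ n) (by positivity) C
      hdouble.isEmptyOrPair fun K hKC hK hne => by
        by_contra hlt
        exact h0.1.2 ⟨K, hK, hne, (not_le.1 hlt).le, hKC⟩
    have h1 : (univ.filter fun M : Finset (Word (n + 1)) =>
        (IsCode (n + 1) M ∧ ¬ IsSplittable s M) ∧ layer M 0 = P ∧ layer M 1 = Q).card ≤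
        (univ.filter fun L : Finset (Word n) => IsEmptyOrPair n L ∧ L ⊆ C).card := by
      refine card_le_card_of_injOn
        (fun M => layer M 2 \ layer M₀ 2 ∪ layer M₀ 2 \ layer M 2) ?_ ?_
      · intro M hM
        simp only [coe_filter, mem_univ, true_and, Set.mem_ofPred_eq] at hM ⊢
        have hsub : layer M 2 ⊆ C := hCM M hM.1.1 hM.2.1 hM.2.2 ▸ subset_union_left
        have hsub0 : layer M₀ 2 ⊆ C := subset_union_left
        exact ⟨hdouble.isEmptyOrPair_symmDiff (hM.1.1.1 2) (h0.1.1.1 2) hsub hsub0,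
          union_subset (sdiff_subset.trans hsub) (sdiff_subset.trans hsub0)⟩
      · intro M hM M' hM' h
        simp only [coe_filter, mem_univ, true_and, Set.mem_ofPred_eq] at hM hM'
        refine hM.1.1.ext_of_layers hM'.1.1 ((hCM M hM.1.1 hM.2.1 hM.2.2).trans
          (hCM M' hM'.1.1 hM'.2.1 hM'.2.2).symm) (hM.2.1.trans hM'.2.1.symm) ?_
        exact symmDiff_left_injective (layer M₀ 2) h
    refine (Nat.cast_le.2 h1).trans (hcount.trans ?_)
    refine Real.rpow_le_rpow_of_exponent_le (by norm_num) ?_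
    have hc : (C.card : ℝ) ≤ 2 ^ n * 2 ^ n := by
      have := card_le_univ C
      rw [card_word] at this
      rw [← mul_pow]
      norm_num
      exact_mod_cast this
    rw [div_le_div_iff₀ (by positivity) hs]
    nlinarith [mul_le_mul_of_nonneg_right hc hs.le]

/-! ### The binary tree of iterated layers -/

section Leaf

variable {n : ℕ}

/-- The iterated layers of `M` along the binary word `v`, read in the letters `0` and `1`. -/
def leaf : ∀ d, Finset (Word (n + d)) → (Fin d → Bool) → Finset (Word n)
  | 0, M, _ => M
  | d + 1, M, v => leaf d (layer (n := n + d) M (if v 0 then 1 else 0)) (Fin.tail v)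

/-- The proportion of binary words of length `d` that have a prefix at which the iterated layer
of `M` is splittable. -/
def splitFrac (s : ℕ → ℝ) : ∀ d, Finset (Word (n + d)) → ℝ
  | 0, _ => 0
  | d + 1, M => if IsSplittable (n := n + d) (s (n + d)) M then 1 else
      (splitFrac s d (layer (n := n + d) M 0) + splitFrac s d (layer (n := n + d) M 1)) / 2

theorem splitFrac_nonneg (s : ℕ → ℝ) (d : ℕ) (M : Finset (Word (n + d))) :
    0 ≤ splitFrac s d M := by
  induction d with
  | zero => exact le_rfl
  | succ d ih =>
    unfold splitFrac
    split_ifs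
    · norm_num
    · linarith [ih (layer (n := n + d) M 0), ih (layer (n := n + d) M 1)]

theorem splitFrac_le_one (s : ℕ → ℝ) (d : ℕ) (M : Finset (Word (n + d))) :
    splitFrac s d M ≤ 1 := by
  induction d with
  | zero => exact zero_le_one
  | succ d ih =>
    unfold splitFrac
    split_ifs
    · norm_num
    · linarith [ih (layer (n := n + d) M 0), ih (layer (n := n + d) M 1)]

theorem IsCode.leaf {d : ℕ} {M : Finset (Word (n + d))} (h : IsCode (n + d) M)
    (v : Fin d → Bool) : IsCode n (leaf d M v) := by
  induction d with
  | zero => exact h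
  | succ d ih => exact ih (h.1 _) _

theorem leaf_disjoint {d : ℕ} {M M' : Finset (Word (n + d))} (h : Disjoint M M')
    (v : Fin d → Bool) : Disjoint (leaf d M v) (leaf d M' v) := by
  induction d with
  | zero => exact h
  | succ d ih => exact ih (layer_disjoint (n := n + d) h _) _

theorem IsCode.leaf_update_disjoint {d : ℕ} {M : Finset (Word (n + d))} (h : IsCode (n + d) M)
    (v : Fin d → Bool) (i : Fin d) :
    Disjoint (DoobGraph.leaf d M v) (DoobGraph.leaf d M (Function.update v i (!v i))) := by
  induction d with
  | zero => exact i.elim0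
  | succ d ih =>
    unfold DoobGraph.leaf
    refine Fin.cases ?_ (fun j => ?_) i
    · simp only [Function.update_self, Fin.tail_update_zero]
      refine leaf_disjoint (IsCode.disjoint_layer h ?_) _
      cases v 0 <;> simp
    · have h1 : Function.update v j.succ (!v j.succ) 0 = v 0 :=
        Function.update_of_ne (Fin.succ_ne_zero j).symm _ _
      rw [h1, Fin.tail_update_succ]
      exact ih (h.1 _) (Fin.tail v) j

/-- A splittable node over `2 ^ d` leaves allows at most `2 ^ (2 ^ d * A)` codes, and nothing below
it is examined; a leaf with no splittable node above it costs `β`. A non-splittable node is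
recovered from its two children by `card_not_isSplittable_le`; `S` accumulates this cost and one bit
per node for the case distinction. The predicate `p` lets the leaves be free or prescribed. -/
theorem sum_weight_leaf_le_one (s S : ℕ → ℝ) (A β : ℝ) (hs : ∀ k, 0 < s k)
    (hdead : ∀ d, ((univ.filter fun M : Finset (Word (n + d + 1)) =>
      IsCode (n + d + 1) M ∧ IsSplittable (s (n + d)) M).card : ℝ) ≤ 2 ^ ((2 : ℝ) ^ (d + 1) * A))
    (hS0 : 0 ≤ S 0)
    (hS : ∀ d, 2 * S d + 1 + 2 ^ (n + d) / s (n + d) ≤ S (d + 1)) (hS1 : ∀ d, 1 ≤ S (d + 1))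
    (d : ℕ) (p : (Fin d → Bool) → Finset (Word n) → Prop)
    (hp : ∀ v, ((univ.filter fun M : Finset (Word n) => IsCode n M ∧ p v M).card : ℝ) ≤ 2 ^ β) :
    ∑ M : Finset (Word (n + d)) with IsCode (n + d) M ∧ ∀ v, p v (leaf d M v),
      (2 : ℝ) ^ (-(2 ^ d * (splitFrac s d M * A + (1 - splitFrac s d M) * β) + S d)) ≤ 1 := by
  induction d with
  | zero =>
    have h := hp Fin.elim0
    have h1 : ∀ M : Finset (Word (n + 0)), (2 : ℝ) ^ (-(2 ^ 0 * (splitFrac s 0 M * A +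
        (1 - splitFrac s 0 M) * β) + S 0)) ≤ (2 ^ β)⁻¹ := by
      intro M
      rw [← Real.rpow_neg (by norm_num)]
      refine Real.rpow_le_rpow_of_exponent_le (by norm_num) ?_
      simp only [splitFrac]
      linarith
    refine (sum_le_sum fun M _ => h1 M).trans ?_
    rw [sum_const, nsmul_eq_mul, ← div_eq_mul_inv, div_le_one (by positivity)]
    refine le_trans (Nat.cast_le.2 (card_le_card fun M hM => ?_)) h
    simp only [mem_filter, mem_univ, true_and] at hM ⊢
    exact ⟨hM.1, hM.2 Fin.elim0⟩
  | succ d ih =>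
    set w : Finset (Word (n + (d + 1))) → ℝ := fun M =>
      (2 : ℝ) ^ (-(2 ^ (d + 1) * (splitFrac s (d + 1) M * A + (1 - splitFrac s (d + 1) M) * β) +
        S (d + 1))) with hw
    set w' : Finset (Word (n + d)) → ℝ := fun M =>
      (2 : ℝ) ^ (-(2 ^ d * (splitFrac s d M * A + (1 - splitFrac s d M) * β) + S d)) with hw'
    set T := univ.filter fun M : Finset (Word (n + (d + 1))) =>
      IsCode (n + (d + 1)) M ∧ ∀ v, p v (leaf (d + 1) M v) with hT
    set T' : Bool → Finset (Finset (Word (n + d))) := fun b =>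
      univ.filter fun M : Finset (Word (n + d)) =>
      IsCode (n + d) M ∧ ∀ v, p (Fin.cons b v) (leaf d M v) with hT'
    have ih' : ∀ b, ∑ M ∈ T' b, w' M ≤ 1 := fun b =>
      ih (fun v => p (Fin.cons b v)) fun v => hp _
    -- Each case gets half of the mass; here `1 ≤ S (d + 1)` supplies the factor.
    have hdeadsum : ∑ M ∈ T with IsSplittable (n := n + d) (s (n + d)) M, w M ≤ 1 / 2 := by
      have h1 : ∀ M ∈ T.filter fun M => IsSplittable (n := n + d) (s (n + d)) M,
          w M ≤ (2 ^ ((2 : ℝ) ^ (d + 1) * A))⁻¹ * (1 / 2) := by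
        intro M hM
        simp only [mem_filter] at hM
        have h2 : splitFrac s (d + 1) M = 1 := by
          unfold splitFrac
          rw [if_pos hM.2]
        simp only [hw, h2]
        rw [← Real.rpow_neg (by norm_num), show (1 / 2 : ℝ) = 2 ^ (-1 : ℝ) by
          rw [Real.rpow_neg (by norm_num)]; norm_num, ← Real.rpow_add (by norm_num)]
        refine Real.rpow_le_rpow_of_exponent_le (by norm_num) ?_
        linarith [hS1 d]
      refine (sum_le_sum h1).trans ?_
      rw [sum_const, nsmul_eq_mul, ← mul_assoc]
      have h2 : ((T.filter fun M => IsSplittable (n := n + d) (s (n + d)) M).card : ℝ) ≤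
          2 ^ ((2 : ℝ) ^ (d + 1) * A) := by
        refine le_trans (Nat.cast_le.2 (card_le_card fun M hM => ?_)) (hdead d)
        simp only [hT, mem_filter, mem_univ, true_and] at hM ⊢
        exact ⟨hM.1.1, hM.2⟩
      have h3 := mul_inv_le_one_of_le₀ h2 (by positivity)
      linarith
    have halive : ∑ M ∈ T with ¬ IsSplittable (n := n + d) (s (n + d)) M, w M ≤ 1 / 2 := by
      set φ : Finset (Word (n + (d + 1))) → Finset (Word (n + d)) × Finset (Word (n + d)) :=
        fun M => (layer (n := n + d) M 0, layer (n := n + d) M 1) with hφ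
      set thr : ℝ := 2 ^ (n + d) / s (n + d) with hthr
      have hmaps : ∀ M ∈ T.filter fun M => ¬ IsSplittable (n := n + d) (s (n + d)) M,
          φ M ∈ T' false ×ˢ T' true := by
        intro M hM
        simp only [hT, mem_filter, mem_univ, true_and] at hM
        simp only [hφ, hT', mem_product, mem_filter, mem_univ, true_and]
        refine ⟨⟨hM.1.1.1 0, fun v => ?_⟩, hM.1.1.1 1, fun v => ?_⟩
        · simpa [leaf] using hM.1.2 (Fin.cons false v)
        · simpa [leaf] using hM.1.2 (Fin.cons true v)
      have hpt : ∀ M ∈ T.filter fun M => ¬ IsSplittable (n := n + d) (s (n + d)) M,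
          w M ≤ w' (φ M).1 * w' (φ M).2 * ((2 ^ thr)⁻¹ * (1 / 2)) := by
        intro M hM
        simp only [mem_filter] at hM
        have h2 : splitFrac s (d + 1) M = (splitFrac s d (layer (n := n + d) M 0) +
            splitFrac s d (layer (n := n + d) M 1)) / 2 := by
          rw [splitFrac, if_neg hM.2]
        simp only [hw, hw', hφ, h2]
        rw [← Real.rpow_neg (by norm_num), show (1 / 2 : ℝ) = 2 ^ (-1 : ℝ) by
          rw [Real.rpow_neg (by norm_num)]; norm_num, ← Real.rpow_add (by norm_num),
          ← Real.rpow_add (by norm_num), ← Real.rpow_add (by norm_num)]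
        refine Real.rpow_le_rpow_of_exponent_le (by norm_num) ?_
        have := hS d
        rw [pow_succ]
        linarith
      refine (sum_le_sum hpt).trans ?_
      rw [← sum_fiberwise_of_maps_to hmaps]
      have hin : ∀ q ∈ T' false ×ˢ T' true,
          ∑ M ∈ (T.filter fun M => ¬ IsSplittable (n := n + d) (s (n + d)) M) with φ M = q,
            w' (φ M).1 * w' (φ M).2 * ((2 ^ thr)⁻¹ * (1 / 2)) ≤ w' q.1 * w' q.2 * (1 / 2) := by
        intro q _
        have h1 : ∑ M ∈ (T.filter fun M => ¬ IsSplittable (n := n + d) (s (n + d)) M)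
            with φ M = q, w' (φ M).1 * w' (φ M).2 * ((2 ^ thr)⁻¹ * (1 / 2)) =
            ∑ M ∈ (T.filter fun M => ¬ IsSplittable (n := n + d) (s (n + d)) M)
            with φ M = q, w' q.1 * w' q.2 * ((2 ^ thr)⁻¹ * (1 / 2)) := by
          refine sum_congr rfl fun M hM => ?_
          rw [(mem_filter.1 hM).2]
        rw [h1, sum_const, nsmul_eq_mul]
        have h2 : (((T.filter fun M => ¬ IsSplittable (n := n + d) (s (n + d)) M).filter
            fun M => φ M = q).card : ℝ) ≤ 2 ^ thr := by
          refine le_trans (Nat.cast_le.2 (card_le_card fun M hM => ?_))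
            (card_not_isSplittable_le (hs (n + d)) q.1 q.2)
          simp only [hT, hφ, mem_filter, mem_univ, true_and, Prod.ext_iff] at hM ⊢
          exact ⟨⟨hM.1.1.1, hM.1.2⟩, hM.2⟩
        have h3 := mul_inv_le_one_of_le₀ h2 (by positivity)
        have h4 : 0 ≤ w' q.1 * w' q.2 * (1 / 2) := by
          simp only [hw']; positivity
        calc _ = (_ * (2 ^ thr)⁻¹) * (w' q.1 * w' q.2 * (1 / 2)) := by ring
          _ ≤ _ := mul_le_of_le_one_left h4 h3
      refine (sum_le_sum hin).trans ?_
      rw [← sum_mul, sum_product]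
      simp only [← mul_sum, ← sum_mul]
      have h0 : 0 ≤ ∑ M ∈ T' true, w' M := sum_nonneg fun M _ => by
        simp only [hw']; positivity
      have := mul_le_one₀ (ih' false) h0 (ih' true)
      linarith
    change ∑ M ∈ T, w M ≤ 1
    refine le_trans (le_of_eq ?_) ((add_le_add hdeadsum halive).trans (by norm_num))
    exact (sum_filter_add_sum_filter_not T
      (fun M => IsSplittable (n := n + d) (s (n + d)) M) w).symm

end Leaf

/-! ### Families of codes on the binary cube -/

/-- Change the `i`-th letter of a binary word. -/
def flipBit {d : ℕ} (v : Fin d → Bool) (i : Fin d) : Fin d → Bool := Function.update v i (!v i)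

theorem flipBit_flipBit {d : ℕ} (v : Fin d → Bool) (i : Fin d) : flipBit (flipBit v i) i = v := by
  simp [flipBit]

/-- The sum of the labels of the letters `true` of a binary word. -/
def labelSum {d : ℕ} {Γ : Type*} [AddCommGroup Γ] (e : Fin d → Γ) (v : Fin d → Bool) : Γ :=
  ∑ i, if v i then e i else 0

theorem labelSum_flipBit {d : ℕ} {Γ : Type*} [AddCommGroup Γ] (hΓ : ∀ g : Γ, g + g = 0)
    (e : Fin d → Γ) (v : Fin d → Bool) (i : Fin d) :
    labelSum e (flipBit v i) = labelSum e v + e i := by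
  unfold labelSum
  rw [← Finset.add_sum_erase univ _ (mem_univ i),
    ← Finset.add_sum_erase univ (fun i => if v i then e i else 0) (mem_univ i)]
  have h : ∑ j ∈ univ.erase i, (if flipBit v i j = true then e j else 0) =
      ∑ j ∈ univ.erase i, (if v j = true then e j else 0) := by
    refine sum_congr rfl fun j hj => ?_
    rw [flipBit, Function.update_of_ne (ne_of_mem_erase hj)]
  rw [h]
  cases hv : v i
  · simp [flipBit, hv, add_comm]
  · simp [flipBit, hv]
    rw [sub_eq_iff_eq_add, add_assoc, hΓ, add_zero]

/-- For each colour `j`, the words are partitioned into the neighbourhoods of the words of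
colour `j`. -/
def neighborEquiv {d : ℕ} {Γ : Type*} [AddCommGroup Γ] (hΓ : ∀ g : Γ, g + g = 0)
    (e : Fin d ≃ Γ) (j : Γ) : (Fin d → Bool) ≃ {v : Fin d → Bool // labelSum e v = j} × Fin d where
  -- The labels run through `Γ` exactly once, so exactly one flip of `u` reaches colour `j`.
  toFun u := (⟨flipBit u (e.symm (j - labelSum e u)), by simp [labelSum_flipBit hΓ]⟩,
    e.symm (j - labelSum e u))
  invFun q := flipBit q.1.1 q.2
  left_inv u := by simp [flipBit_flipBit]
  right_inv q := by
    obtain ⟨⟨v, rfl⟩, i⟩ := q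
    have h : e.symm (labelSum e v - labelSum e (flipBit v i)) = i := by
      rw [labelSum_flipBit hΓ, sub_add_cancel_left, neg_eq_of_add_eq_zero_left (hΓ (e i)),
        Equiv.symm_apply_apply]
    simp only [Prod.mk.injEq, Subtype.mk.injEq]
    rw [h]
    exact ⟨flipBit_flipBit v i, rfl⟩

/-- The families of codes indexed by binary words in which neighbouring codes are disjoint. -/
def cubeHoms (n d : ℕ) : Finset ((Fin d → Bool) → Finset (Word n)) :=
  univ.filter fun X => (∀ v, IsCode n (X v)) ∧ ∀ v i, Disjoint (X v) (X (flipBit v i))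

theorem leaf_mem_cubeHoms {n d : ℕ} {M : Finset (Word (n + d))} (h : IsCode (n + d) M) :
    leaf d M ∈ cubeHoms n d := by
  simp only [cubeHoms, mem_filter, mem_univ, true_and]
  exact ⟨fun v => h.leaf v, fun v i => h.leaf_update_disjoint v i⟩

theorem card_cubeHoms_succ_le (n d : ℕ) :
    (cubeHoms n (d + 1)).card ≤ (cubeHoms n d).card ^ 2 := by
  rw [sq, ← card_product]
  refine card_le_card_of_injOn (fun X => (fun v => X (Fin.cons false v),
    fun v => X (Fin.cons true v))) ?_ ?_
  · intro X hX
    simp only [cubeHoms, coe_filter, mem_univ, true_and, Set.mem_ofPred_eq] at hX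
    have key : ∀ b (v : Fin d → Bool) i, flipBit (Fin.cons b v : Fin (d + 1) → Bool) i.succ =
        Fin.cons b (flipBit v i) := by
      intro b v i
      simp [flipBit, Fin.cons_update]
    simp only [coe_product, cubeHoms, coe_filter, mem_univ, true_and, Set.mem_prod,
      Set.mem_ofPred_eq]
    refine ⟨⟨fun v => hX.1 _, fun v i => ?_⟩, fun v => hX.1 _, fun v i => ?_⟩
    · rw [← key]; exact hX.2 _ _
    · rw [← key]; exact hX.2 _ _
  · intro X _ X' _ h
    simp only [Prod.mk.injEq] at h
    funext v
    rw [← Fin.cons_self_tail v]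
    cases v 0
    · exact congrFun h.1 _
    · exact congrFun h.2 _

/-- The union of the codes at the neighbours of `v`. -/
def neighborUnion {n d : ℕ} (Y : (Fin d → Bool) → Finset (Word n)) (v : Fin d → Bool) :
    Finset (Word n) :=
  univ.biUnion fun i => Y (flipBit v i)

/-- From two families, let `Y` follow the first on even vertices and the second on odd ones, and let
the companion do the reverse. The companion's code at `v` avoids all codes of `Y` at neighbours of
`v`, so once `Y` is given its values may be chosen independently. -/
theorem card_cubeHoms_sq_le_sum (n d : ℕ) :
    (cubeHoms n d).card ^ 2 ≤
      ∑ Y : (Fin d → Bool) → {M : Finset (Word n) // IsCode n M},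
        ∏ v, codeCount (neighborUnion (fun u => (Y u).1) v)ᶜ := by
  have hsum : ∑ Y : (Fin d → Bool) → {M : Finset (Word n) // IsCode n M},
        ∏ v, codeCount (neighborUnion (fun u => (Y u).1) v)ᶜ =
      (univ.sigma fun Y : (Fin d → Bool) → {M : Finset (Word n) // IsCode n M} =>
        Fintype.piFinset fun v => univ.filter fun M : Finset (Word n) =>
          IsCode n M ∧ M ⊆ (neighborUnion (fun u => (Y u).1) v)ᶜ).card := by
    rw [card_sigma]
    simp only [Fintype.card_piFinset]
    rfl
  rw [hsum, sq, ← card_product]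
  set par : (Fin d → Bool) → ZMod 2 := labelSum fun _ => 1 with hpar
  have hpar' : ∀ v i, par (flipBit v i) = par v + 1 := fun v i =>
    labelSum_flipBit (by decide) _ v i
  refine card_le_card_of_surjOn (fun p : (Y : (Fin d → Bool) →
      {M : Finset (Word n) // IsCode n M}) × ((Fin d → Bool) → Finset (Word n)) =>
    ((fun v => if par v = 0 then (p.1 v).1 else p.2 v),
      fun v => if par v = 0 then p.2 v else (p.1 v).1)) ?_
  rintro ⟨X, X'⟩ hX
  simp only [coe_product, cubeHoms, coe_filter, mem_univ, true_and, Set.mem_prod,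
    Set.mem_ofPred_eq] at hX
  obtain ⟨⟨hX, hXd⟩, hX', hXd'⟩ := hX
  refine ⟨⟨fun v => ⟨if par v = 0 then X v else X' v, ?_⟩,
    fun v => if par v = 0 then X' v else X v⟩, ?_, ?_⟩
  · split_ifs
    exacts [hX v, hX' v]
  · simp only [coe_sigma, coe_univ, Set.mem_sigma_iff, Set.mem_univ, true_and, mem_coe,
      Fintype.mem_piFinset, mem_filter, mem_univ]
    intro v
    constructor
    · split_ifs
      exacts [hX' v, hX v]
    · rw [le_compl_iff_disjoint_right, neighborUnion, disjoint_biUnion_right]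
      intro i _
      rw [hpar' v i]
      have h01 : ∀ a : ZMod 2, a ≠ 0 → a + 1 = 0 := by decide
      by_cases h : par v = 0
      · simp only [h, if_true, zero_add, one_ne_zero, if_false]
        exact hXd' v i
      · simp only [h, h01 _ h, if_true, if_false]
        exact hXd v i
  · simp only [Prod.mk.injEq]
    constructor <;> funext v <;> split_ifs <;> rfl

/-- Sort tuples by their union `U`. At most `codeCount U ^ d` tuples lie inside `U`, so each of the
`2 ^ (4 ^ n)` sets contributes at most one. -/
theorem sum_inv_codeCount_le_one (n d : ℕ) :
    ∑ z : Fin d → {M : Finset (Word n) // IsCode n M},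
      ((codeCount (univ.biUnion fun i => (z i).1) : ℝ)⁻¹) ^ d ≤ 2 ^ (4 ^ n) := by
  have h1 : ∀ z : Fin d → {M : Finset (Word n) // IsCode n M},
      ((codeCount (univ.biUnion fun i => (z i).1) : ℝ)⁻¹) ^ d ≤
      ∑ U : Finset (Word n), if ∀ i, (z i).1 ⊆ U then ((codeCount U : ℝ)⁻¹) ^ d else 0 := by
    intro z
    have h2 : ∀ i, (z i).1 ⊆ univ.biUnion fun i => (z i).1 := fun i =>
      subset_biUnion_of_mem (fun i => (z i).1) (mem_univ i)
    refine le_trans (by rw [if_pos h2]) (single_le_sum (f := fun U : Finset (Word n) =>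
      if ∀ i, (z i).1 ⊆ U then ((codeCount U : ℝ)⁻¹) ^ d else 0) (fun U _ => ?_)
      (mem_univ (univ.biUnion fun i => (z i).1)))
    split_ifs <;> positivity
  refine (sum_le_sum fun z _ => h1 z).trans ?_
  rw [sum_comm]
  have h3 : ∀ U : Finset (Word n), ∑ z : Fin d → {M : Finset (Word n) // IsCode n M},
      (if ∀ i, (z i).1 ⊆ U then ((codeCount U : ℝ)⁻¹) ^ d else 0) ≤ 1 := by
    intro U
    rw [← sum_filter, sum_const, nsmul_eq_mul]
    have h4 : (univ.filter fun z : Fin d → {M : Finset (Word n) // IsCode n M} =>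
        ∀ i, (z i).1 ⊆ U).card ≤ codeCount U ^ d := by
      have : (Fintype.piFinset fun _ : Fin d => univ.filter fun M : Finset (Word n) =>
          IsCode n M ∧ M ⊆ U).card = codeCount U ^ d := by
        rw [Fintype.card_piFinset_const]
        rfl
      rw [← this]
      refine card_le_card_of_injOn (fun z i => (z i).1) ?_ ?_
      · intro z hz
        simp only [coe_filter, mem_univ, true_and, Set.mem_ofPred_eq] at hz
        simp only [mem_coe, Fintype.mem_piFinset, mem_filter, mem_univ, true_and]
        exact fun i => ⟨(z i).2, hz i⟩
      · intro z _ z' _ h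
        funext i
        exact Subtype.ext (congrFun h i)
    rw [inv_pow]
    exact mul_inv_le_one_of_le₀ (by exact_mod_cast h4) (by positivity)
  refine (sum_le_sum fun U _ => h3 U).trans ?_
  simp [card_word]

/-- The neighbourhoods of the vertices of colour `j` partition the cube, so the sum over `Y` factors
into independent sums over `d`-tuples. -/
theorem sum_prod_color_le {n d : ℕ} {Γ : Type*} [AddCommGroup Γ] (hΓ : ∀ g : Γ, g + g = 0)
    (e : Fin d ≃ Γ) (j : Γ) (q : Finset (Word n) → ℝ)
    (hq : ∑ z : Fin d → {M : Finset (Word n) // IsCode n M},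
      q (univ.biUnion fun i => (z i).1) ≤ 1) (hq0 : ∀ U, 0 ≤ q U) :
    ∑ Y : (Fin d → Bool) → {M : Finset (Word n) // IsCode n M},
      ∏ v with labelSum e v = j, q (neighborUnion (fun u => (Y u).1) v) ≤ 1 := by
  have h1 : ∑ Y : (Fin d → Bool) → {M : Finset (Word n) // IsCode n M},
      ∏ v with labelSum e v = j, q (neighborUnion (fun u => (Y u).1) v) =
      ∑ Z : {v : Fin d → Bool // labelSum e v = j} →
        Fin d → {M : Finset (Word n) // IsCode n M},
        ∏ v, q (univ.biUnion fun i => (Z v i).1) := by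
    refine Fintype.sum_equiv ((Equiv.arrowCongr (neighborEquiv hΓ e j)
      (Equiv.refl _)).trans (Equiv.curry _ _ _)) _ _ fun Y => ?_
    rw [Finset.prod_subtype (p := fun v => labelSum e v = j) _ (by simp)]
    rfl
  rw [h1]
  have h2 := Finset.prod_univ_sum
    (fun _ : {v : Fin d → Bool // labelSum e v = j} =>
      (univ : Finset (Fin d → {M : Finset (Word n) // IsCode n M})))
    (fun _ z => q (univ.biUnion fun i => (z i).1))
  rw [Fintype.piFinset_univ] at h2
  rw [← h2]
  exact prod_le_one (fun _ _ => sum_nonneg fun z _ => hq0 _) fun _ _ => hq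

/-- In `card_cubeHoms_sq_le_sum`, the factor at `v` is at most `2 ^ (2 ^ (n + 1)) / codeCount U`
with `U` the union over the neighbours. The arithmetic–geometric mean inequality over the `d`
colours bounds the product of reciprocals by an average of products of `d`-th powers over one
colour, to which `sum_prod_color_le` applies. -/
theorem card_cubeHoms_sq_le_of_equiv {n d : ℕ} (hd : d = 4 ^ (n + 1)) {Γ : Type*} [AddCommGroup Γ]
    [Fintype Γ] (hΓ : ∀ g : Γ, g + g = 0) (e : Fin d ≃ Γ) :
    ((cubeHoms (n + 1) d).card : ℝ) ^ 2 ≤ 2 ^ (((2 : ℝ) ^ (n + 1) + 1) * 2 ^ d) := by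
  have hdpos : 0 < d := by rw [hd]; positivity
  -- The `d`-th power of `2⁻¹` cancels the number `2 ^ (4 ^ (n + 1))` of sets `U`; the price is the
  -- `+ 1` in the exponent.
  set q : Finset (Word (n + 1)) → ℝ := fun U => (codeCount U : ℝ)⁻¹ * 2⁻¹ with hq
  have hq0 : ∀ U, 0 ≤ q U := fun U => by simp only [hq]; positivity
  have hq1 : ∑ z : Fin d → {M : Finset (Word (n + 1)) // IsCode (n + 1) M},
      q (univ.biUnion fun i => (z i).1) ^ d ≤ 1 := by
    simp only [hq, mul_pow, ← sum_mul]
    rw [inv_pow 2 d, ← div_eq_mul_inv, div_le_one (by positivity)]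
    exact (sum_inv_codeCount_le_one (n + 1) d).trans_eq (by rw [hd])
  have hcard : Fintype.card Γ = d := by rw [← Fintype.card_congr e, Fintype.card_fin]
  have hcol : ∑ Y : (Fin d → Bool) → {M : Finset (Word (n + 1)) // IsCode (n + 1) M},
      ∏ v, q (neighborUnion (fun u => (Y u).1) v) ≤ 1 := by
    have hpt : ∀ Y : (Fin d → Bool) → {M : Finset (Word (n + 1)) // IsCode (n + 1) M},
        ∏ v, q (neighborUnion (fun u => (Y u).1) v) ≤ ∑ j : Γ, (d : ℝ)⁻¹ *
          ∏ v with labelSum e v = j, q (neighborUnion (fun u => (Y u).1) v) ^ d := by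
      intro Y
      have h1 := Real.geom_mean_le_arith_mean_weighted (univ : Finset Γ) (fun _ => (d : ℝ)⁻¹)
        (fun j => ∏ v with labelSum e v = j, q (neighborUnion (fun u => (Y u).1) v) ^ d)
        (fun _ _ => by positivity) (by
          rw [sum_const, card_univ, hcard, nsmul_eq_mul]
          field_simp)
        (fun j _ => prod_nonneg fun v _ => pow_nonneg (hq0 _) _)
      refine le_trans (le_of_eq ?_) h1
      have h2 : ∀ j : Γ, (∏ v with labelSum e v = j,
          q (neighborUnion (fun u => (Y u).1) v) ^ d) ^ (d : ℝ)⁻¹ =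
          ∏ v with labelSum e v = j, q (neighborUnion (fun u => (Y u).1) v) := by
        intro j
        rw [prod_pow, Real.pow_rpow_inv_natCast (prod_nonneg fun v _ => hq0 _) hdpos.ne']
      simp only [h2]
      exact (prod_fiberwise univ (labelSum e) _).symm
    refine (sum_le_sum fun Y _ => hpt Y).trans ?_
    rw [sum_comm]
    have h3 : ∀ j : Γ, ∑ Y : (Fin d → Bool) → {M : Finset (Word (n + 1)) // IsCode (n + 1) M},
        (d : ℝ)⁻¹ * ∏ v with labelSum e v = j, q (neighborUnion (fun u => (Y u).1) v) ^ d ≤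
        (d : ℝ)⁻¹ := by
      intro j
      rw [← mul_sum]
      exact mul_le_of_le_one_right (by positivity)
        (sum_prod_color_le hΓ e j (fun U => q U ^ d) hq1 fun U => pow_nonneg (hq0 U) d)
    refine (sum_le_sum fun j _ => h3 j).trans ?_
    rw [sum_const, card_univ, hcard, nsmul_eq_mul]
    have : (d : ℝ) ≠ 0 := by positivity
    field_simp
    exact le_rfl
  have hbound : ∀ Y : (Fin d → Bool) → {M : Finset (Word (n + 1)) // IsCode (n + 1) M},
      ((∏ v, codeCount (neighborUnion (fun u => (Y u).1) v)ᶜ : ℕ) : ℝ) ≤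
        (2 ^ ((2 : ℝ) ^ (n + 1) + 1)) ^ (2 ^ d) *
          ∏ v, q (neighborUnion (fun u => (Y u).1) v) := by
    intro Y
    have hc : (2 ^ d : ℕ) = (univ : Finset (Fin d → Bool)).card := by simp
    rw [Nat.cast_prod, hc, ← prod_const, ← prod_mul_distrib]
    refine prod_le_prod (fun v _ => by positivity) fun v _ => ?_
    set U := neighborUnion (fun u => (Y u).1) v with hU
    have h1 := codeCount_mul_codeCount_compl_le U
    have h2 : 0 < codeCount U := by
      unfold codeCount
      refine card_pos.2 ⟨(Y (flipBit v ⟨0, hdpos⟩)).1, ?_⟩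
      simp only [mem_filter, mem_univ, true_and]
      exact ⟨(Y _).2, subset_biUnion_of_mem (fun i => (Y (flipBit v i)).1) (mem_univ _)⟩
    have h3 : (0 : ℝ) < codeCount U := by exact_mod_cast h2
    rw [Real.rpow_add (by norm_num), Real.rpow_one]
    simp only [hq]
    have : (2 : ℝ) ^ (2 : ℝ) ^ (n + 1) * 2 * ((codeCount U : ℝ)⁻¹ * 2⁻¹) =
        (2 : ℝ) ^ (2 : ℝ) ^ (n + 1) / codeCount U := by
      field_simp
    rw [this, le_div_iff₀ h3]
    linarith
  have hmain := card_cubeHoms_sq_le_sum (n + 1) d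
  calc ((cubeHoms (n + 1) d).card : ℝ) ^ 2
      ≤ ((∑ Y : (Fin d → Bool) → {M : Finset (Word (n + 1)) // IsCode (n + 1) M},
        ∏ v, codeCount (neighborUnion (fun u => (Y u).1) v)ᶜ : ℕ) : ℝ) := by exact_mod_cast hmain
    _ ≤ ∑ Y : (Fin d → Bool) → {M : Finset (Word (n + 1)) // IsCode (n + 1) M},
        (2 ^ ((2 : ℝ) ^ (n + 1) + 1)) ^ (2 ^ d) *
          ∏ v, q (neighborUnion (fun u => (Y u).1) v) := by
      rw [Nat.cast_sum]
      exact sum_le_sum fun Y _ => hbound Y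
    _ ≤ (2 ^ ((2 : ℝ) ^ (n + 1) + 1)) ^ (2 ^ d) := by
      rw [← mul_sum]
      exact mul_le_of_le_one_right (by positivity) hcol
    _ = 2 ^ (((2 : ℝ) ^ (n + 1) + 1) * 2 ^ d) := by
      rw [← Real.rpow_natCast, ← Real.rpow_mul (by norm_num)]
      push_cast
      rfl

/-- An elementary abelian 2-group of order `4 ^ (n + 1)` labels the smallest cube; an extra
dimension squares both sides. -/
theorem card_cubeHoms_sq_le {n D : ℕ} (hD : 4 ^ (n + 1) ≤ D) :
    ((cubeHoms (n + 1) D).card : ℝ) ^ 2 ≤ 2 ^ (((2 : ℝ) ^ (n + 1) + 1) * 2 ^ D) := by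
  induction D, hD using Nat.le_induction with
  | base =>
    refine card_cubeHoms_sq_le_of_equiv rfl (Γ := Fin (2 * (n + 1)) → ZMod 2)
      (fun g => funext fun i => CharTwo.add_self_eq_zero _) ?_
    refine (Fintype.equivFinOfCardEq ?_).symm
    rw [Fintype.card_fun, ZMod.card, Fintype.card_fin, pow_mul]
    norm_num
  | succ D _ ih =>
    have h1 : ((cubeHoms (n + 1) (D + 1)).card : ℝ) ≤ (cubeHoms (n + 1) D).card ^ 2 := by
      exact_mod_cast card_cubeHoms_succ_le (n + 1) D
    have h2 := h1.trans ih
    refine (pow_le_pow_left₀ (by positivity) h2 2).trans (le_of_eq ?_)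
    rw [← Real.rpow_natCast, ← Real.rpow_mul (by norm_num)]
    congr 1
    push_cast
    ring

/-! ### Bootstrapping the exponent -/

open Filter Topology

/-- The number of distance-2 MDS codes of length `n` over four letters. -/
def codeNum (n : ℕ) : ℕ := (univ.filter (IsCode n)).card

/-- Markov's inequality for the tree weights with free leaves, each costing `β`. -/
theorem card_high_splitFrac_le {n : ℕ} (s S : ℕ → ℝ) (A β : ℝ) (hs : ∀ k, 0 < s k)
    (hdead : ∀ d, ((univ.filter fun M : Finset (Word (n + d + 1)) =>
      IsCode (n + d + 1) M ∧ IsSplittable (s (n + d)) M).card : ℝ) ≤ 2 ^ ((2 : ℝ) ^ (d + 1) * A))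
    (hS0 : 0 ≤ S 0)
    (hS : ∀ d, 2 * S d + 1 + 2 ^ (n + d) / s (n + d) ≤ S (d + 1)) (hS1 : ∀ d, 1 ≤ S (d + 1))
    (hβ : (codeNum n : ℝ) ≤ 2 ^ β) (d : ℕ) (θ Λ : ℝ)
    (hΛ : ∀ μ, θ ≤ μ → μ ≤ 1 → 2 ^ d * (μ * A + (1 - μ) * β) + S d ≤ Λ) :
    ((univ.filter fun M : Finset (Word (n + d)) =>
      IsCode (n + d) M ∧ θ ≤ splitFrac s d M).card : ℝ) ≤ 2 ^ Λ := by
  have h := sum_weight_leaf_le_one s S A β hs hdead hS0 hS hS1 d (fun _ _ => True)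
    (fun v => by simpa [codeNum] using hβ)
  have h1 : ((univ.filter fun M : Finset (Word (n + d)) =>
      IsCode (n + d) M ∧ θ ≤ splitFrac s d M).card : ℝ) * (2 ^ Λ)⁻¹ ≤ 1 := by
    refine le_trans ?_ h
    rw [← nsmul_eq_mul, ← sum_const]
    refine (sum_le_sum fun M hM => ?_).trans (sum_le_sum_of_subset_of_nonneg (fun M hM => ?_)
      fun M _ _ => by positivity)
    · simp only [mem_filter, mem_univ, true_and] at hM
      rw [← Real.rpow_neg (by norm_num)]
      exact Real.rpow_le_rpow_of_exponent_le (by norm_num)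
        (neg_le_neg (hΛ _ hM.2 (splitFrac_le_one _ _ _)))
    · simp only [mem_filter, mem_univ, true_and, implies_true, and_true] at hM ⊢
      exact hM.1
  rwa [← div_eq_mul_inv, div_le_one (by positivity)] at h1

/-- Markov's inequality with all leaves prescribed, hence `β = 0`, summed over the possible leaf
families in `cubeHoms`. -/
theorem card_low_splitFrac_le {n : ℕ} (s S : ℕ → ℝ) (A : ℝ) (hs : ∀ k, 0 < s k)
    (hdead : ∀ d, ((univ.filter fun M : Finset (Word (n + d + 1)) =>
      IsCode (n + d + 1) M ∧ IsSplittable (s (n + d)) M).card : ℝ) ≤ 2 ^ ((2 : ℝ) ^ (d + 1) * A))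
    (hS0 : 0 ≤ S 0)
    (hS : ∀ d, 2 * S d + 1 + 2 ^ (n + d) / s (n + d) ≤ S (d + 1)) (hS1 : ∀ d, 1 ≤ S (d + 1))
    (d : ℕ) (θ Λ : ℝ) (hΛ : ∀ μ, 0 ≤ μ → μ ≤ θ → 2 ^ d * (μ * A) + S d ≤ Λ) :
    ((univ.filter fun M : Finset (Word (n + d)) =>
      IsCode (n + d) M ∧ splitFrac s d M ≤ θ).card : ℝ) ≤ (cubeHoms n d).card * 2 ^ Λ := by
  have h := fun X : (Fin d → Bool) → Finset (Word n) =>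
    sum_weight_leaf_le_one s S A 0 hs hdead hS0 hS hS1 d (fun v M => M = X v)
    (fun v => by
      rw [Real.rpow_zero]
      rw [Nat.cast_le_one, card_le_one]
      intro M hM M' hM'
      simp only [mem_filter, mem_univ, true_and] at hM hM'
      exact hM.2.trans hM'.2.symm)
  have h1 : ((univ.filter fun M : Finset (Word (n + d)) =>
      IsCode (n + d) M ∧ splitFrac s d M ≤ θ).card : ℝ) * (2 ^ Λ)⁻¹ ≤ (cubeHoms n d).card := by
    rw [← nsmul_eq_mul, ← sum_const, ← sum_fiberwise_of_maps_to (t := cubeHoms n d)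
      (g := leaf d) (fun M hM => leaf_mem_cubeHoms (mem_filter.1 hM).2.1)]
    have h2 : ∀ X ∈ cubeHoms n d, ∑ M ∈ (univ.filter fun M : Finset (Word (n + d)) =>
        IsCode (n + d) M ∧ splitFrac s d M ≤ θ) with leaf d M = X, ((2 : ℝ) ^ Λ)⁻¹ ≤ 1 := by
      intro X _
      refine le_trans ?_ (h X)
      refine (sum_le_sum fun M hM => ?_).trans (sum_le_sum_of_subset_of_nonneg (fun M hM => ?_)
        fun M _ _ => by positivity)
      · simp only [mem_filter, mem_univ, true_and] at hM
        rw [← Real.rpow_neg (by norm_num)]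
        refine Real.rpow_le_rpow_of_exponent_le (by norm_num) (neg_le_neg ?_)
        rw [mul_zero, add_zero]
        exact hΛ _ (splitFrac_nonneg _ _ _) hM.1.2
      · simp only [mem_filter, mem_univ, true_and] at hM ⊢
        exact ⟨hM.1.1, fun v => congrFun hM.2 v⟩
    refine (sum_le_sum h2).trans ?_
    simp
  rwa [← div_eq_mul_inv, div_le_iff₀ (by positivity)] at h1

/-- The assertion that the number of codes of length `N` is at most `2 ^ ((1 + t) 2 ^ (N - 1))` for
all large `N`. -/
def EventuallyBounded (t : ℝ) : Prop :=
  ∀ᶠ N : ℕ in atTop, (codeNum N : ℝ) ≤ 2 ^ ((1 + t) * (2 ^ N / 2))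

theorem eventuallyBounded_two : EventuallyBounded 2 := by
  filter_upwards [eventually_ge_atTop 1] with N hN
  obtain ⟨n, rfl⟩ := Nat.exists_eq_add_of_le' hN
  refine (card_isCode_le (n := n)).trans (le_of_eq ?_)
  congr 1
  rw [pow_succ]
  ring

theorem EventuallyBounded.mono {t t' : ℝ} (h : EventuallyBounded t) (htt' : t ≤ t') :
    EventuallyBounded t' := by
  filter_upwards [h] with N hN
  refine hN.trans (Real.rpow_le_rpow_of_exponent_le (by norm_num) ?_)
  gcongr

/-- Bound on the number of components of non-splittable double-codes. -/
def splitBound (k : ℕ) : ℝ := (4 / 3) ^ k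

/-- Accumulated cost of recovering a code from its iterated layers. -/
def splitCost (n d : ℕ) : ℝ :=
  (1 + 2 * (3 / 2) ^ n) * 2 ^ d - 1 - 2 * (3 / 2) ^ n * (3 / 2) ^ d

theorem splitCost_succ (n d : ℕ) :
    2 * splitCost n d + 1 + 2 ^ (n + d) / splitBound (n + d) = splitCost n (d + 1) := by
  unfold splitCost splitBound
  rw [← div_pow, show (2 / (4 / 3) : ℝ) = 3 / 2 by norm_num, pow_add, pow_succ, pow_succ]
  ring

theorem splitCost_nonneg (n d : ℕ) : 0 ≤ splitCost n d := by
  induction d with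
  | zero => simp [splitCost]
  | succ d ih =>
    rw [← splitCost_succ]
    have : 0 < 2 ^ (n + d) / splitBound (n + d) := by unfold splitBound; positivity
    linarith

theorem one_le_splitCost_succ (n d : ℕ) : 1 ≤ splitCost n (d + 1) := by
  rw [← splitCost_succ]
  have : 0 < 2 ^ (n + d) / splitBound (n + d) := by unfold splitBound; positivity
  linarith [splitCost_nonneg n d]

/-- In units of `2 ^ (N - 1)` and up to small errors, codes of split fraction `μ` have exponent at
most `μ + (1 - μ) * (1 + t)` with free leaves, and `1 + μ` with prescribed leaves and the cube
bound. The first is nonincreasing in `μ`, the second increasing; they meet at `μ = t / (1 + t)` with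
value `1 + t / (1 + t)`. -/
theorem EventuallyBounded.improve {t : ℝ} (ht : 0 ≤ t) (h : EventuallyBounded t) {δ : ℝ}
    (hδ : 0 < δ) : EventuallyBounded (t / (1 + t) + δ) := by
  -- Three units of `η` absorb the errors of the two counts, the fourth the factor 2 from adding
  -- them.
  set η := δ / 4 with hη
  have hη0 : 0 < η := by positivity
  -- Here `(8 / 9) ^ k` is `splitBound k ^ 2 / 2 ^ k`. The base `4 / 3` lies between 1 and `√2`:
  -- small enough for few small sets, large enough for the recovery cost in `lim2` to vanish.
  have lim1 : Tendsto (fun k : ℕ => 5 * ((k : ℝ) * (8 / 9 : ℝ) ^ k)) atTop (𝓝 0) := by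
    simpa using (tendsto_self_mul_const_pow_of_lt_one (r := 8 / 9) (by norm_num)
      (by norm_num)).const_mul 5
  have lim2 : Tendsto (fun k : ℕ => 2 * (1 / 2 : ℝ) ^ k + 4 * (3 / 4 : ℝ) ^ k) atTop (𝓝 0) := by
    simpa using ((tendsto_pow_atTop_nhds_zero_of_lt_one (r := (1 / 2 : ℝ)) (by norm_num)
      (by norm_num)).const_mul 2).add ((tendsto_pow_atTop_nhds_zero_of_lt_one (r := (3 / 4 : ℝ))
      (by norm_num) (by norm_num)).const_mul 4)
  obtain ⟨n₁, hn₁⟩ := eventually_atTop.1 (lim1.eventually (gt_mem_nhds hη0))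
  obtain ⟨n₂, hn₂⟩ := eventually_atTop.1 (lim2.eventually (gt_mem_nhds hη0))
  obtain ⟨n₃, hn₃⟩ := eventually_atTop.1 h
  set m := n₁ + n₂ + n₃ with hm
  set n := m + 1 with hn
  have hsmall : 2 * (1 / 2 : ℝ) ^ n + 4 * (3 / 4 : ℝ) ^ n < η := hn₂ n (by omega)
  have hpow : (0 : ℝ) < 2 ^ n := by positivity
  have hsmall' : 2 + 4 * (3 / 2 : ℝ) ^ n ≤ η * 2 ^ n := by
    have h1 := mul_le_mul_of_nonneg_right hsmall.le hpow.le
    rw [add_mul, mul_assoc, mul_assoc, ← mul_pow, ← mul_pow] at h1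
    norm_num at h1
    linarith
  have h32 : (0 : ℝ) < (3 / 2) ^ n := by positivity
  have hdead : ∀ d, ((univ.filter fun M : Finset (Word (n + d + 1)) =>
      IsCode (n + d + 1) M ∧ IsSplittable (splitBound (n + d)) M).card : ℝ) ≤
      2 ^ ((2 : ℝ) ^ (d + 1) * ((1 + η) * (2 ^ n / 2))) := by
    intro d
    obtain ⟨k, hk⟩ : ∃ k, n + d = k + 1 := ⟨m + d, by omega⟩
    have hk1 := hn₁ (n + d) (by omega)
    have hexp : (2 : ℝ) ^ (d + 1) * ((1 + η) * (2 ^ n / 2)) = (1 + η) * 2 ^ (n + d) := by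
      rw [pow_succ, pow_add]; ring
    rw [hexp]
    rw [hk] at hk1 ⊢
    refine (card_isSplittable_le k _).trans (Real.rpow_le_rpow_of_exponent_le (by norm_num) ?_)
    have h2 : (0 : ℝ) < 2 ^ (k + 1) := by positivity
    have h1 := mul_le_mul_of_nonneg_right hk1.le h2.le
    have h3 : (8 / 9 : ℝ) ^ (k + 1) * 2 ^ (k + 1) = splitBound (k + 1) ^ 2 := by
      unfold splitBound
      rw [← mul_pow, ← pow_mul, mul_comm (k + 1) 2, pow_mul]
      norm_num
    rw [← h3]
    linarith
  have hS0 : 0 ≤ splitCost n 0 := splitCost_nonneg n 0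
  have hS : ∀ d, 2 * splitCost n d + 1 + 2 ^ (n + d) / splitBound (n + d) ≤ splitCost n (d + 1) :=
    fun d => (splitCost_succ n d).le
  have hS1 := one_le_splitCost_succ n
  have hs : ∀ k, 0 < splitBound k := fun k => by unfold splitBound; positivity
  have hβ : (codeNum n : ℝ) ≤ 2 ^ ((1 + t) * (2 ^ n / 2)) := hn₃ n (by omega)
  set θ := t / (1 + t) with hθ
  have hθ0 : 0 ≤ θ := by positivity
  have hθ1 : θ ≤ 1 := by rw [hθ, div_le_one (by positivity)]; linarith
  have hθt : θ * t = t - θ := by rw [hθ]; field_simp; ring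
  -- The leaf length `n` stays fixed; the depth must reach `4 ^ n` for `card_cubeHoms_sq_le`.
  refine eventually_atTop.2 ⟨n + 4 ^ n, fun N hN => ?_⟩
  obtain ⟨D, rfl⟩ : ∃ D, N = n + D :=
    Nat.exists_eq_add_of_le ((Nat.le_add_right _ _).trans hN)
  have hD : 4 ^ (m + 1) ≤ D := Nat.le_of_add_le_add_left hN
  have hDpos : (1 : ℝ) ≤ 2 ^ D := one_le_pow₀ (by norm_num)
  set H : ℝ := 2 ^ (n + D) / 2 with hH
  have hH' : H = 2 ^ D * (2 ^ n / 2) := by rw [hH, pow_add]; ring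
  have hHpos : 0 < H := by rw [hH]; positivity
  have hηH : 2 ^ D * (1 + 2 * (3 / 2 : ℝ) ^ n) ≤ η * H := by
    rw [hH']
    nlinarith
  have hcost : splitCost n D ≤ η * H := by
    refine le_trans ?_ hηH
    unfold splitCost
    have : 0 < 2 * (3 / 2 : ℝ) ^ n * (3 / 2) ^ D := by positivity
    linarith
  have h1H : 1 ≤ η * H := le_trans (by nlinarith) hηH
  have high := card_high_splitFrac_le splitBound (splitCost n) _ _ hs hdead hS0 hS hS1 hβ D θ
    ((1 + θ + 3 * η) * H) (by
      intro μ hμ hμ1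
      have e : (2 : ℝ) ^ D * (μ * ((1 + η) * (2 ^ n / 2)) + (1 - μ) * ((1 + t) * (2 ^ n / 2))) =
          (μ * (1 + η) + (1 - μ) * (1 + t)) * H := by rw [hH']; ring
      rw [e]
      have : μ * (1 + η) + (1 - μ) * (1 + t) ≤ 1 + θ + η := by nlinarith
      nlinarith)
  have low := card_low_splitFrac_le splitBound (splitCost n) _ hs hdead hS0 hS hS1 D θ
    ((θ + 2 * η) * H) (by
      intro μ hμ0 hμ
      have e : (2 : ℝ) ^ D * (μ * ((1 + η) * (2 ^ n / 2))) = (μ * (1 + η)) * H := by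
        rw [hH']; ring
      rw [e]
      have : μ * (1 + η) ≤ θ + η := by nlinarith
      nlinarith)
  have hhom : ((cubeHoms n D).card : ℝ) ≤ 2 ^ ((1 + η) * H) := by
    have h1 := card_cubeHoms_sq_le hD
    have h2 : (2 : ℝ) ^ (((2 : ℝ) ^ (m + 1) + 1) * 2 ^ D) ≤ (2 ^ ((1 + η) * H)) ^ 2 := by
      rw [← Real.rpow_natCast (2 ^ ((1 + η) * H)), ← Real.rpow_mul (by norm_num)]
      refine Real.rpow_le_rpow_of_exponent_le (by norm_num) ?_
      rw [hH', ← hn]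
      push_cast
      nlinarith
    exact (pow_le_pow_iff_left₀ (by positivity) (by positivity) (by norm_num)).1 (h1.trans h2)
  have low' : ((univ.filter fun M : Finset (Word (n + D)) =>
      IsCode (n + D) M ∧ splitFrac splitBound D M ≤ θ).card : ℝ) ≤
      2 ^ ((1 + θ + 3 * η) * H) := by
    refine low.trans ((mul_le_mul_of_nonneg_right hhom (by positivity)).trans (le_of_eq ?_))
    rw [← Real.rpow_add (by norm_num)]
    congr 1
    ring
  have hunion : (univ.filter (IsCode (n + D))) ⊆
      (univ.filter fun M : Finset (Word (n + D)) =>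
        IsCode (n + D) M ∧ θ ≤ splitFrac splitBound D M) ∪
      (univ.filter fun M : Finset (Word (n + D)) =>
        IsCode (n + D) M ∧ splitFrac splitBound D M ≤ θ) := by
    intro M hM
    simp only [mem_filter, mem_univ, true_and, mem_union] at hM ⊢
    rcases le_total θ (splitFrac splitBound D M) with h | h
    · exact Or.inl ⟨hM, h⟩
    · exact Or.inr ⟨hM, h⟩
  have hcard : (codeNum (n + D) : ℝ) ≤ 2 * 2 ^ ((1 + θ + 3 * η) * H) := by
    have h1 := (card_le_card hunion).trans (card_union_le _ _)
    have h2 : (codeNum (n + D) : ℝ) ≤ _ := Nat.cast_le.2 h1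
    push_cast at h2
    linarith
  refine hcard.trans ?_
  rw [← Real.rpow_one_add' (by norm_num) (by positivity)]
  refine Real.rpow_le_rpow_of_exponent_le (by norm_num) ?_
  have : δ = 4 * η := by rw [hη]; ring
  rw [this]
  linarith

theorem eventuallyBounded_of_pos {η : ℝ} (hη : 0 < η) : EventuallyBounded η := by
  set T := {t : ℝ | 0 ≤ t ∧ EventuallyBounded t} with hT
  have hne : T.Nonempty := ⟨2, by norm_num, eventuallyBounded_two⟩
  have hbdd : BddBelow T := ⟨0, fun t ht => ht.1⟩
  have hinf0 : 0 ≤ sInf T := le_csInf hne fun t ht => ht.1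
  have hle : ∀ t ∈ T, sInf T ≤ t / (1 + t) := by
    intro t ht
    refine le_of_forall_pos_le_add fun δ hδ => csInf_le hbdd ⟨?_, ht.2.improve ht.1 hδ⟩
    have := ht.1
    positivity
  have hzero : sInf T = 0 := by
    by_contra hpos
    have hpos : 0 < sInf T := lt_of_le_of_ne hinf0 (Ne.symm hpos)
    have hlt : ∀ t ∈ T, sInf T * (1 + t) ≤ t := fun t ht => by
      have h1 := ht.1
      exact (le_div_iff₀ (by linarith)).1 (hle t ht)
    -- Writing `i` for the infimum, `i * (1 + t) ≤ t` and `i ≤ t` give `i + i ^ 2 ≤ t` for every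
    -- admissible `t`.
    have : sInf T + sInf T ^ 2 ≤ sInf T := by
      refine le_csInf hne fun t ht => ?_
      have h1 := hlt t ht
      have h2 := csInf_le hbdd ht
      nlinarith
    nlinarith
  obtain ⟨t, ht, hlt⟩ := exists_lt_of_csInf_lt hne (by rw [hzero]; exact hη)
  exact ht.2.mono hlt.le

/-! ### From Doob graphs to the Hamming graph -/

/-- The independent sets that contain a quarter of all vertices. -/
def quarterSets {V : Type*} [Fintype V] (G : SimpleGraph V) : Finset (Finset V) :=
  univ.filter fun S => G.IsIndepSet (S : Set V) ∧ 4 * S.card = Fintype.card V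

theorem mem_quarterSets {V : Type*} [Fintype V] {G : SimpleGraph V} {S : Finset V} :
    S ∈ quarterSets G ↔ G.IsIndepSet (S : Set V) ∧ 4 * S.card = Fintype.card V := by
  simp [quarterSets]

theorem isIndepSet_map {V W : Type*} {G : SimpleGraph V} {H : SimpleGraph W} (e : G ≃g H)
    {S : Finset V} (hS : G.IsIndepSet (S : Set V)) :
    H.IsIndepSet ((S.map e.toEquiv.toEmbedding : Finset W) : Set W) := by
  intro x hx y hy hxy hadj
  simp only [coe_map, Set.mem_image, mem_coe] at hx hy
  obtain ⟨x, hx, rfl⟩ := hx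
  obtain ⟨y, hy, rfl⟩ := hy
  exact hS (mem_coe.2 hx) (mem_coe.2 hy) (fun h => hxy (by rw [h])) (e.map_adj_iff.1 hadj)

theorem card_quarterSets_le_of_iso {V W : Type*} [Fintype V] [Fintype W] {G : SimpleGraph V}
    {H : SimpleGraph W} (e : G ≃g H) : (quarterSets G).card ≤ (quarterSets H).card := by
  refine card_le_card_of_injOn (fun S => S.map e.toEquiv.toEmbedding) (fun S hS => ?_)
    ((Finset.map_injective _).injOn)
  rw [mem_coe, mem_quarterSets] at hS ⊢
  refine ⟨isIndepSet_map e hS.1, ?_⟩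
  rw [card_map, hS.2, Fintype.card_congr e.toEquiv]

/-- The slice of a subset of a product over a point of the second factor. -/
def slice {V W : Type*} [Fintype V] (S : Finset (V × W)) (w : W) : Finset V :=
  univ.filter fun v => (v, w) ∈ S

theorem mem_slice {V W : Type*} [Fintype V] {S : Finset (V × W)} {w : W} {v : V} :
    v ∈ slice S w ↔ (v, w) ∈ S := by simp [slice]

theorem card_eq_sum_slice {V W : Type*} [Fintype V] [Fintype W] (S : Finset (V × W)) :
    S.card = ∑ w, (slice S w).card := by
  have h : S.card = ∑ p : V × W, if p ∈ S then 1 else 0 := by simp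
  rw [h, Fintype.sum_prod_type_right]
  refine sum_congr rfl fun w _ => ?_
  rw [Finset.sum_boole]
  rfl

theorem isIndepSet_slice {V W : Type*} [Fintype V] {G : SimpleGraph V} {H : SimpleGraph W}
    {S : Finset (V × W)} (hS : (G □ H).IsIndepSet (S : Set (V × W))) (w : W) :
    G.IsIndepSet (slice S w : Set V) := by
  intro x hx y hy hxy hadj
  rw [mem_coe, mem_slice] at hx hy
  exact hS (mem_coe.2 hx) (mem_coe.2 hy) (fun h => hxy (congrArg Prod.fst h))
    (SimpleGraph.boxProd_adj.2 (Or.inl ⟨hadj, rfl⟩))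

theorem disjoint_slice {V W : Type*} [Fintype V] {G : SimpleGraph V} {H : SimpleGraph W}
    {S : Finset (V × W)} (hS : (G □ H).IsIndepSet (S : Set (V × W))) {w w' : W}
    (h : H.Adj w w') : Disjoint (slice S w) (slice S w') := by
  rw [Finset.disjoint_left]
  intro x hx hx'
  rw [mem_slice] at hx hx'
  exact hS (mem_coe.2 hx) (mem_coe.2 hx') (fun h' => h.ne (congrArg Prod.snd h'))
    (SimpleGraph.boxProd_adj.2 (Or.inr ⟨h, rfl⟩))

theorem card_le_of_slice_le {V W : Type*} [Fintype V] [Fintype W] {S : Finset (V × W)} {c : ℕ}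
    (h : ∀ w, (slice S w).card ≤ c) : S.card ≤ c * Fintype.card W := by
  rw [card_eq_sum_slice, mul_comm]
  refine (sum_le_sum fun w _ => h w).trans ?_
  simp

theorem card_slice_eq {V W : Type*} [Fintype V] [Fintype W] {S : Finset (V × W)} {c : ℕ}
    (h : ∀ w, (slice S w).card ≤ c) (hS : S.card = c * Fintype.card W) (w : W) :
    (slice S w).card = c := by
  have h1 : ∑ w, (slice S w).card = ∑ _w : W, c := by
    rw [← card_eq_sum_slice, hS]
    simp [mul_comm]
  exact (sum_eq_sum_iff_of_le fun w _ => h w).1 h1 w (mem_univ w)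

theorem card_le_one_of_isIndepSet_top {S : Finset (Fin 4)}
    (hS : (⊤ : SimpleGraph (Fin 4)).IsIndepSet (S : Set (Fin 4))) : S.card ≤ 1 := by
  rw [card_le_one]
  intro a ha b hb
  by_contra hab
  exact hS (mem_coe.2 ha) (mem_coe.2 hb) hab hab

/-- Each Shrikhande slice is one of the sixteen quadruples and is replaced by the graph of its
permutation. Injectivity of each permutation gives independence within a slice,
`shPerm_ne_of_disjoint` between adjacent slices, and `shPerm_injective` makes the replacement
reversible. -/
theorem card_quarterSets_shrikhande_boxProd_le {W : Type*} [Fintype W] (R : SimpleGraph W) :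
    (quarterSets (shrikhande □ R)).card ≤
      (quarterSets ((⊤ : SimpleGraph (Fin 4)) □ ((⊤ : SimpleGraph (Fin 4)) □ R))).card := by
  have hcl : ∀ S : Finset (ZMod 4 × ZMod 4), shrikhande.IsIndepSet (S : Set (ZMod 4 × ZMod 4)) ∧
      S.card = 4 → ∃ i, shIndep i = S := fun S hS => exists_shIndep_eq hS.1 hS.2
  choose! idx hidx using hcl
  have hslice : ∀ S ∈ quarterSets (shrikhande □ R), ∀ w,
      shrikhande.IsIndepSet (slice S w : Set (ZMod 4 × ZMod 4)) ∧ (slice S w).card = 4 := by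
    intro S hS w
    rw [mem_quarterSets] at hS
    refine ⟨isIndepSet_slice hS.1 w,
      card_slice_eq (fun w => card_le_four_of_isIndepSet (isIndepSet_slice hS.1 w)) ?_ w⟩
    have := hS.2
    rw [Fintype.card_prod, Fintype.card_prod, ZMod.card] at this
    omega
  let f : Finset ((ZMod 4 × ZMod 4) × W) → Finset (Fin 4 × (Fin 4 × W)) := fun S =>
    univ.filter fun p => shPerm (idx (slice S p.2.2)) p.2.1 = p.1
  have hf : ∀ S p, p ∈ f S ↔ shPerm (idx (slice S p.2.2)) p.2.1 = p.1 := fun S p => by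
    simp [f]
  refine card_le_card_of_injOn f ?_ ?_
  · intro S hS
    have hSl := hslice S hS
    rw [mem_coe, mem_quarterSets] at hS ⊢
    refine ⟨?_, ?_⟩
    · rintro ⟨a, b, w⟩ hp ⟨a', b', w'⟩ hp' hne hadj
      rw [mem_coe, hf] at hp hp'
      simp only [SimpleGraph.boxProd_adj, SimpleGraph.top_adj, Prod.mk.injEq] at hadj
      dsimp only at hp hp'
      rcases hadj with ⟨h, rfl, rfl⟩ | ⟨⟨h, rfl⟩ | ⟨h, rfl⟩, rfl⟩
      · exact h (hp.symm.trans hp')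
      · exact h (shPerm_apply_injective _ (hp.trans hp'.symm))
      · refine shPerm_ne_of_disjoint (idx (slice S w)) (idx (slice S w')) ?_ b (hp.trans hp'.symm)
        rw [hidx _ (hSl w), hidx _ (hSl w')]
        exact disjoint_slice hS.1 h
    · have : (f S).card = Fintype.card (Fin 4 × W) := by
        rw [card_eq_sum_slice]
        have h1 : ∀ q : Fin 4 × W, (slice (f S) q).card = 1 := by
          intro q
          rw [card_eq_one]
          refine ⟨shPerm (idx (slice S q.2)) q.1, ?_⟩
          ext a
          rw [mem_slice, hf, mem_singleton, eq_comm]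
        simp [h1]
      rw [this, Fintype.card_prod (Fin 4) (Fin 4 × W), Fintype.card_fin]
  · intro S hS S' hS' h
    have hSl := hslice S hS
    have hSl' := hslice S' hS'
    have hw : ∀ w, slice S w = slice S' w := by
      intro w
      rw [← hidx _ (hSl w), ← hidx _ (hSl' w)]
      congr 1
      apply shPerm_injective
      funext b
      have h1 : ((shPerm (idx (slice S w)) b, (b, w)) : Fin 4 × (Fin 4 × W)) ∈ f S := by
        rw [hf]
      rw [h, hf] at h1
      exact h1.symm
    ext ⟨v, w⟩
    rw [← mem_slice (S := S), ← mem_slice (S := S'), hw]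

theorem cartesianPower_adj_succ {V : Type*} (G : SimpleGraph V) (k : ℕ) (x y : Fin (k + 1) → V) :
    (cartesianPower G (k + 1)).Adj x y ↔ (G.Adj (x 0) (y 0) ∧ Fin.tail x = Fin.tail y) ∨
      ((cartesianPower G k).Adj (Fin.tail x) (Fin.tail y) ∧ x 0 = y 0) := by
  constructor
  · rintro ⟨i, hi, h⟩
    revert hi h
    refine Fin.cases ?_ (fun j => ?_) i
    · intro hi h
      exact Or.inl ⟨hi, funext fun j => h j.succ (Fin.succ_ne_zero j)⟩
    · intro hi h
      exact Or.inr ⟨⟨j, hi, fun l hl => h l.succ fun e => hl (Fin.succ_injective _ e)⟩,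
        h 0 (Fin.succ_ne_zero j).symm⟩
  · rintro (⟨h, ht⟩ | ⟨⟨j, hj, h⟩, h0⟩)
    · refine ⟨0, h, fun j hj => ?_⟩
      obtain ⟨l, rfl⟩ := Fin.exists_succ_eq.2 hj
      exact congrFun ht l
    · refine ⟨j.succ, hj, fun l hl => ?_⟩
      revert hl
      refine Fin.cases (fun _ => h0) (fun l hl => ?_) l
      exact h l fun e => hl (by rw [e])

/-- Split off one Shrikhande factor of a Doob graph. -/
def doobSuccLeft (m n : ℕ) : doob (m + 1) n ≃g shrikhande □ doob m n where
  toFun p := (p.1 0, (Fin.tail p.1, p.2))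
  invFun q := (Fin.cons q.1 q.2.1, q.2.2)
  left_inv p := by simp
  right_inv q := by simp
  map_rel_iff' := by
    rintro ⟨x, y⟩ ⟨x', y'⟩
    simp only [Equiv.coe_fn_mk, doob, SimpleGraph.boxProd_adj, cartesianPower_adj_succ,
      Prod.mk.injEq]
    have hx : x = x' ↔ x 0 = x' 0 ∧ Fin.tail x = Fin.tail x' := by
      rw [← Fin.cons_self_tail x, ← Fin.cons_self_tail x', Fin.cons_inj]
      simp
    rw [hx]
    tauto

/-- Split off one complete factor of a Doob graph. -/
def doobSuccRight (m n : ℕ) : doob m (n + 1) ≃g (⊤ : SimpleGraph (Fin 4)) □ doob m n where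
  toFun p := (p.2 0, (p.1, Fin.tail p.2))
  invFun q := (q.2.1, Fin.cons q.1 q.2.2)
  left_inv p := by simp
  right_inv q := by simp
  map_rel_iff' := by
    rintro ⟨x, y⟩ ⟨x', y'⟩
    simp only [Equiv.coe_fn_mk, doob, SimpleGraph.boxProd_adj, cartesianPower_adj_succ,
      Prod.mk.injEq]
    have hy : y = y' ↔ y 0 = y' 0 ∧ Fin.tail y = Fin.tail y' := by
      rw [← Fin.cons_self_tail y, ← Fin.cons_self_tail y', Fin.cons_inj]
      simp
    rw [hy]
    tauto

/-- The box product with a fixed first factor respects isomorphisms. -/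
def boxProdCongrRight {U V W : Type*} (G : SimpleGraph U) {H : SimpleGraph V} {K : SimpleGraph W}
    (e : H ≃g K) : G.boxProd H ≃g G.boxProd K where
  toEquiv := Equiv.prodCongr (Equiv.refl U) e.toEquiv
  map_rel_iff' := by
    rintro ⟨a, b⟩ ⟨a', b'⟩
    have h : K.Adj (e b) (e b') ↔ H.Adj b b' := e.map_rel_iff
    simp [SimpleGraph.boxProd_adj, h]

theorem card_quarterSets_doob_le (m n : ℕ) :
    (quarterSets (doob m n)).card ≤ (quarterSets (doob 0 (n + 2 * m))).card := by
  induction m generalizing n with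
  | zero => exact le_rfl
  | succ m ih =>
    refine (card_quarterSets_le_of_iso (doobSuccLeft m n)).trans
      ((card_quarterSets_shrikhande_boxProd_le _).trans ?_)
    refine (card_quarterSets_le_of_iso ((boxProdCongrRight ⊤ (doobSuccRight m n).symm).trans
      (doobSuccRight m (n + 1)).symm)).trans ((ih (n + 2)).trans (le_of_eq ?_))
    rw [show n + 2 * (m + 1) = n + 2 + 2 * m by ring]

/-- The Hamming graph on words. -/
def wordGraph : ∀ n, SimpleGraph (Word n)
  | 0 => ⊥
  | n + 1 => ((⊤ : SimpleGraph (Fin 4)) □ wordGraph n : SimpleGraph (Fin 4 × Word n))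

theorem nonempty_doob_iso_wordGraph (n : ℕ) : Nonempty (doob 0 n ≃g wordGraph n) := by
  induction n with
  | zero =>
    refine ⟨⟨⟨fun _ => (), fun _ => (Fin.elim0, Fin.elim0), fun p => ?_, fun _ => rfl⟩, ?_⟩⟩
    · exact Subsingleton.elim _ _
    · intro a b
      rw [Subsingleton.elim a b]
      simp
  | succ n ih =>
    obtain ⟨e⟩ := ih
    exact ⟨(doobSuccRight 0 n).trans (boxProdCongrRight ⊤ e)⟩

theorem wordGraph_isIndepSet_layer {n : ℕ} {M : Finset (Word (n + 1))}
    (h : (wordGraph (n + 1)).IsIndepSet (M : Set (Word (n + 1)))) (a : Fin 4) :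
    (wordGraph n).IsIndepSet (layer M a : Set (Word n)) := by
  intro x hx y hy hxy hadj
  rw [mem_coe, mem_layer] at hx hy
  exact h (mem_coe.2 hx) (mem_coe.2 hy) (fun e => hxy (congrArg Prod.snd e))
    (SimpleGraph.boxProd_adj.2 (Or.inr ⟨hadj, rfl⟩))

theorem wordGraph_card_fiber_le {n : ℕ} {M : Finset (Word (n + 1))}
    (h : (wordGraph (n + 1)).IsIndepSet (M : Set (Word (n + 1)))) (x : Word n) :
    (fiber M x).card ≤ 1 := by
  rw [card_le_one]
  intro a ha b hb
  rw [mem_fiber] at ha hb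
  by_contra hab
  exact h (mem_coe.2 ha) (mem_coe.2 hb) (fun e => hab (congrArg Prod.fst e))
    (SimpleGraph.boxProd_adj.2 (Or.inl ⟨hab, rfl⟩))

theorem wordGraph_card_le {n : ℕ} {M : Finset (Word (n + 1))}
    (h : (wordGraph (n + 1)).IsIndepSet (M : Set (Word (n + 1)))) : M.card ≤ 4 ^ n := by
  rw [card_eq_sum_fiber]
  refine (sum_le_sum fun x _ => wordGraph_card_fiber_le h x).trans ?_
  simp [card_word]

theorem isCode_of_isIndepSet {n : ℕ} {M : Finset (Word (n + 1))}
    (h : (wordGraph (n + 1)).IsIndepSet (M : Set (Word (n + 1)))) (hM : M.card = 4 ^ n) :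
    IsCode (n + 1) M := by
  induction n with
  | zero =>
    refine ⟨fun _ => trivial, fun x => ?_⟩
    have h1 : ∑ x, (fiber M x).card = ∑ _x : Word 0, 1 := by
      rw [← card_eq_sum_fiber, hM]
      simp [card_word]
    exact (sum_eq_sum_iff_of_le fun x _ => wordGraph_card_fiber_le h x).1 h1 x (mem_univ x)
  | succ n ih =>
    refine ⟨fun a => ih (wordGraph_isIndepSet_layer h a) ?_, fun x => ?_⟩
    · have h1 : ∑ a, (layer M a).card = ∑ _a : Fin 4, 4 ^ n := by
        rw [← card_eq_sum_layer, hM]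
        simp [pow_succ, mul_comm]
      exact (sum_eq_sum_iff_of_le fun a _ =>
        wordGraph_card_le (wordGraph_isIndepSet_layer h a)).1 h1 a (mem_univ a)
    · have h1 : ∑ x, (fiber M x).card = ∑ _x : Word (n + 1), 1 := by
        rw [← card_eq_sum_fiber, hM]
        simp [card_word]
      exact (sum_eq_sum_iff_of_le fun x _ => wordGraph_card_fiber_le h x).1 h1 x (mem_univ x)

theorem card_quarterSets_wordGraph_le (n : ℕ) :
    (quarterSets (wordGraph (n + 1))).card ≤ codeNum (n + 1) := by
  refine card_le_card fun M hM => ?_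
  rw [mem_quarterSets, card_word, pow_succ] at hM
  simp only [mem_filter, mem_univ, true_and]
  exact isCode_of_isIndepSet hM.1 (by omega)

theorem card_quarterSets_doob_le_codeNum {m n : ℕ} (h : 1 ≤ 2 * m + n) :
    (quarterSets (doob m n)).card ≤ codeNum (2 * m + n) := by
  obtain ⟨k, hk⟩ := Nat.exists_eq_add_of_le' h
  refine (card_quarterSets_doob_le m n).trans ?_
  obtain ⟨e⟩ := nonempty_doob_iso_wordGraph (n + 2 * m)
  refine (card_quarterSets_le_of_iso e).trans ?_
  rw [add_comm n, hk]
  exact card_quarterSets_wordGraph_le k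

/-- A single factor forces the ratio: in each of its copies an independent set has at most a quarter
of the vertices. -/
theorem four_mul_card_le_of_isIndepSet {m n : ℕ} (h : 1 ≤ 2 * m + n)
    {S : Finset ((Fin m → ZMod 4 × ZMod 4) × (Fin n → Fin 4))}
    (hS : (doob m n).IsIndepSet (S : Set ((Fin m → ZMod 4 × ZMod 4) × (Fin n → Fin 4)))) :
    4 * S.card ≤ Fintype.card ((Fin m → ZMod 4 × ZMod 4) × (Fin n → Fin 4)) := by
  obtain _ | m := m
  · obtain ⟨n, rfl⟩ : ∃ k, n = k + 1 := ⟨n - 1, by omega⟩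
    have h1 := isIndepSet_map (doobSuccRight 0 n) hS
    have h2 := card_le_of_slice_le fun w => card_le_one_of_isIndepSet_top (isIndepSet_slice h1 w)
    rw [card_map] at h2
    rw [Fintype.card_congr (doobSuccRight 0 n).toEquiv, Fintype.card_prod (Fin 4),
      Fintype.card_fin]
    omega
  · have h1 := isIndepSet_map (doobSuccLeft m n) hS
    have h2 := card_le_of_slice_le fun w => card_le_four_of_isIndepSet (isIndepSet_slice h1 w)
    rw [card_map] at h2
    rw [Fintype.card_congr (doobSuccLeft m n).toEquiv, Fintype.card_prod (ZMod 4 × ZMod 4),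
      Fintype.card_prod (ZMod 4), ZMod.card]
    omega

/-! ### The lower bound by switching blocks -/

/-- The vertex set of `D(m, n)`. -/
abbrev Vertex (m n : ℕ) : Type := (Fin m → ZMod 4 × ZMod 4) × (Fin n → Fin 4)

/-- The index set of a partition of the vertices of `D(m, n)` into products of 4-cycles and
edges. -/
abbrev Block (m n : ℕ) : Type := (Fin m → ZMod 4) × (Fin n → ZMod 2)

/-- The block of a vertex. -/
def block {m n : ℕ} (v : Vertex m n) : Block m n :=
  (fun i => (v.1 i).2, fun j => high (v.2 j))

/-- The parity of a block. -/
def blockParity {m n : ℕ} (b : Block m n) : ZMod 2 := ∑ i, parity (b.1 i) + ∑ j, b.2 j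

/-- The parity of the position of a vertex inside its block. -/
def innerParity {m n : ℕ} (v : Vertex m n) : ZMod 2 :=
  ∑ i, parity (v.1 i).1 + ∑ j, low (v.2 j)

theorem sum_sub_sum_of_agree {k : ℕ} {V : Type*} (f : V → ZMod 2) {x y : Fin k → V} (i : Fin k)
    (h : ∀ j, j ≠ i → x j = y j) : ∑ j, f (x j) - ∑ j, f (y j) = f (x i) - f (y i) := by
  rw [← sum_sub_distrib]
  exact sum_eq_single i (fun j _ hj => by rw [h j hj, sub_self]) (by simp)

/-- Distinct blocks of equal parity are thus not joined by edges, and each block is bipartite with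
classes given by `innerParity`. -/
theorem block_of_adj {m n : ℕ} {v w : Vertex m n} (h : (doob m n).Adj v w) :
    blockParity (block v) ≠ blockParity (block w) ∨
      (block v = block w ∧ innerParity v ≠ innerParity w) := by
  obtain ⟨x, y⟩ := v
  obtain ⟨x', y'⟩ := w
  simp only [doob, SimpleGraph.boxProd_adj] at h
  rcases h with ⟨⟨i, hi, hx⟩, rfl⟩ | ⟨⟨i, hi, hy⟩, rfl⟩
  · rw [shrikhande_adj_iff] at hi
    rcases parity_ne_of_shAdj _ _ hi with h1 | ⟨h1, h2⟩
    · left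
      have := sum_sub_sum_of_agree (fun u : ZMod 4 × ZMod 4 => parity u.2) i hx
      simp only [blockParity, block]
      rw [← sub_ne_zero] at h1 ⊢
      rwa [add_sub_add_right_eq_sub, this]
    · right
      refine ⟨?_, ?_⟩
      · simp only [block, Prod.mk.injEq, and_true]
        funext j
        by_cases hj : j = i
        · rw [hj, h1]
        · rw [hx j hj]
      · have := sum_sub_sum_of_agree (fun u : ZMod 4 × ZMod 4 => parity u.1) i hx
        simp only [innerParity]
        rw [← sub_ne_zero] at h2 ⊢
        rwa [add_sub_add_right_eq_sub, this]
  · rcases high_ne_of_ne _ _ hi.ne with h1 | ⟨h1, h2⟩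
    · left
      have := sum_sub_sum_of_agree high i hy
      simp only [blockParity, block]
      rw [← sub_ne_zero] at h1 ⊢
      rwa [add_sub_add_left_eq_sub, this]
    · right
      refine ⟨?_, ?_⟩
      · simp only [block, Prod.mk.injEq, true_and]
        funext j
        by_cases hj : j = i
        · rw [hj, h1]
        · rw [hy j hj]
      · have := sum_sub_sum_of_agree low i hy
        simp only [innerParity]
        rw [← sub_ne_zero] at h2 ⊢
        rwa [add_sub_add_left_eq_sub, this]

/-- The independent set defined by a parity of blocks and a function on blocks. -/
def parityClass {m n : ℕ} (c : ZMod 2) (f : Block m n → ZMod 2) : Finset (Vertex m n) :=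
  univ.filter fun v => blockParity (block v) = c ∧ innerParity v = f (block v)

theorem mem_parityClass {m n : ℕ} {c : ZMod 2} {f : Block m n → ZMod 2} {v : Vertex m n} :
    v ∈ parityClass c f ↔ blockParity (block v) = c ∧ innerParity v = f (block v) := by
  simp [parityClass]

theorem isIndepSet_parityClass {m n : ℕ} (c : ZMod 2) (f : Block m n → ZMod 2) :
    (doob m n).IsIndepSet (parityClass c f : Set (Vertex m n)) := by
  intro v hv w hw _ hadj
  rw [mem_coe, mem_parityClass] at hv hw
  rcases block_of_adj hadj with h | ⟨h, h'⟩
  · exact h (hv.1.trans hw.1.symm)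
  · exact h' (by rw [hv.2, hw.2, h])

/-- Varying the parity and shifting `f` by one gives four independent sets that cover all vertices.
Each has at most a quarter of them, hence exactly a quarter. -/
theorem four_mul_card_parityClass {m n : ℕ} (h : 1 ≤ 2 * m + n) (f : Block m n → ZMod 2) :
    4 * (parityClass 0 f).card = Fintype.card (Vertex m n) := by
  have hle (c : ZMod 2) (g : Block m n → ZMod 2) :
      4 * (parityClass c g).card ≤ Fintype.card (Vertex m n) :=
    four_mul_card_le_of_isIndepSet h (isIndepSet_parityClass c g)
  have hcover : (univ : Finset (Vertex m n)) ⊆ (parityClass 0 f ∪ parityClass 0 fun b => f b + 1) ∪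
      (parityClass 1 f ∪ parityClass 1 fun b => f b + 1) := by
    intro v _
    simp only [mem_union, mem_parityClass]
    have h1 : ∀ a : ZMod 2, a = 0 ∨ a = 1 := by decide
    have h2 : ∀ a b : ZMod 2, a = b ∨ a = b + 1 := by decide
    rcases h1 (blockParity (block v)) with h | h <;>
      rcases h2 (innerParity v) (f (block v)) with h' | h' <;> simp [h, h']
  have h1 := card_le_card hcover
  have h2 := h1.trans (card_union_le _ _)
  have h3 := card_union_le (parityClass 0 f) (parityClass 0 fun b => f b + 1)
  have h4 := card_union_le (parityClass 1 f) (parityClass 1 fun b => f b + 1)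
  rw [card_univ] at h2
  have k1 := hle 0 f
  have k2 := hle 0 fun b => f b + 1
  have k3 := hle 1 f
  have k4 := hle 1 fun b => f b + 1
  omega

theorem block_surjective {m n : ℕ} : Function.Surjective (block : Vertex m n → Block m n) := by
  rintro ⟨b, c⟩
  choose g hg using high_surjective
  exact ⟨(fun i => (0, b i), fun j => g (c j)), by simp [block, hg]⟩

theorem exists_blockParity_shift {m n : ℕ} (h : 1 ≤ 2 * m + n) :
    ∃ σ : Block m n → Block m n, Function.Injective σ ∧
      ∀ b, blockParity (σ b) = blockParity b + 1 := by
  obtain _ | m := m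
  · obtain ⟨n, rfl⟩ : ∃ k, n = k + 1 := ⟨n - 1, by omega⟩
    refine ⟨fun b => (b.1, Fin.cons (b.2 0 + 1) (Fin.tail b.2)), ?_, fun b => ?_⟩
    · rintro ⟨b, c⟩ ⟨b', c'⟩ h
      simp only [Prod.mk.injEq, Fin.cons_inj, add_left_inj] at h
      rw [h.1, ← Fin.cons_self_tail c, ← Fin.cons_self_tail c', h.2.1, h.2.2]
    · simp only [blockParity, Fin.sum_univ_succ, Fin.cons_zero, Fin.cons_succ, Fin.tail]
      ring
  · refine ⟨fun b => (Fin.cons (b.1 0 + 1) (Fin.tail b.1), b.2), ?_, fun b => ?_⟩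
    · rintro ⟨b, c⟩ ⟨b', c'⟩ h
      simp only [Prod.mk.injEq, Fin.cons_inj, add_left_inj] at h
      rw [h.2, ← Fin.cons_self_tail b, ← Fin.cons_self_tail b', h.1.1, h.1.2]
    · simp only [blockParity, Fin.sum_univ_succ, Fin.cons_zero, Fin.cons_succ, Fin.tail,
        parity_add_one]
      ring

theorem two_pow_le_card_even_blocks {m n : ℕ} (h : 1 ≤ 2 * m + n) :
    2 ^ (2 * m + n - 1) ≤ Fintype.card {b : Block m n // blockParity b = 0} := by
  obtain ⟨σ, hσ, hσp⟩ := exists_blockParity_shift h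
  have h1 : (univ.filter fun b : Block m n => ¬ blockParity b = 0).card ≤
      (univ.filter fun b : Block m n => blockParity b = 0).card := by
    refine card_le_card_of_injOn σ (fun b hb => ?_) hσ.injOn
    simp only [coe_filter, mem_univ, true_and, Set.mem_ofPred_eq] at hb ⊢
    rw [hσp]
    revert hb
    generalize blockParity b = a
    revert a
    decide
  have h2 := card_filter_add_card_filter_not (s := (univ : Finset (Block m n)))
    (fun b => blockParity b = 0)
  have h3 : (univ : Finset (Block m n)).card = 2 ^ (2 * m + n) := by
    rw [card_univ, Fintype.card_prod, Fintype.card_fun, Fintype.card_fun, ZMod.card, ZMod.card,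
      Fintype.card_fin, Fintype.card_fin, pow_add, pow_mul]
    norm_num
  rw [Fintype.card_subtype]
  obtain ⟨k, hk⟩ := Nat.exists_eq_add_of_le' h
  rw [hk] at h3 ⊢
  rw [pow_succ] at h3
  simp only [Nat.add_sub_cancel]
  omega

theorem isMaximumIndepSet_iff {m n : ℕ} (h : 1 ≤ 2 * m + n) (S : Finset (Vertex m n)) :
    (doob m n).IsMaximumIndepSet S ↔ S ∈ quarterSets (doob m n) := by
  rw [mem_quarterSets]
  constructor
  · intro hS
    refine ⟨hS.isIndepSet, ?_⟩
    have h1 := hS.maximum _ (isIndepSet_parityClass 0 0)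
    have h2 := four_mul_card_parityClass h (0 : Block m n → ZMod 2)
    have h3 : 4 * S.card ≤ Fintype.card (Vertex m n) :=
      four_mul_card_le_of_isIndepSet h hS.isIndepSet
    have h4 : 4 * S.card = Fintype.card (Vertex m n) := by omega
    exact h4
  · intro hS
    refine ⟨hS.1, fun T hT => ?_⟩
    have := four_mul_card_le_of_isIndepSet h hT
    omega

theorem numMDS_eq {m n : ℕ} (h : 1 ≤ 2 * m + n) : numMDS m n = (quarterSets (doob m n)).card := by
  unfold numMDS
  rw [← Set.ncard_coe_finset]
  congr 1
  ext S
  exact isMaximumIndepSet_iff h S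

/-- The function is free on even blocks. Every block contains a vertex, and membership of that
vertex reveals which of the two values was chosen. -/
theorem two_pow_le_numMDS {m n : ℕ} (h : 1 ≤ 2 * m + n) :
    2 ^ 2 ^ (2 * m + n - 1) ≤ numMDS m n := by
  rw [numMDS_eq h]
  have h1 : Fintype.card ({b : Block m n // blockParity b = 0} → ZMod 2) ≤
      (quarterSets (doob m n)).card := by
    rw [← card_univ]
    refine card_le_card_of_injOn (fun g => parityClass 0 fun b =>
      if hb : blockParity b = 0 then g ⟨b, hb⟩ else 0) (fun g _ => ?_) ?_
    · rw [mem_coe, mem_quarterSets]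
      exact ⟨isIndepSet_parityClass _ _, four_mul_card_parityClass h _⟩
    · intro g _ g' _ hgg
      funext ⟨b, hb⟩
      obtain ⟨v, rfl⟩ := block_surjective b
      have hv : ∀ g : {b : Block m n // blockParity b = 0} → ZMod 2,
          v ∈ (parityClass 0 fun b => if hb : blockParity b = 0 then g ⟨b, hb⟩ else 0) ↔
            innerParity v = g ⟨block v, hb⟩ := by
        intro g
        rw [mem_parityClass, dif_pos hb]
        exact and_iff_right hb
      have h2 := hv g
      rw [show (parityClass 0 fun b => if hb : blockParity b = 0 then g ⟨b, hb⟩ else 0) = _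
        from hgg, hv g'] at h2
      revert h2
      generalize innerParity v = a
      generalize g ⟨block v, hb⟩ = c
      generalize g' ⟨block v, hb⟩ = c'
      revert a c c'
      decide
  refine le_trans ?_ h1
  rw [Fintype.card_fun, ZMod.card]
  exact Nat.pow_le_pow_right (by norm_num) (two_pow_le_card_even_blocks h)

theorem numMDS_pos (m n : ℕ) : 0 < numMDS m n := by
  unfold numMDS
  rw [Set.ncard_pos]
  exact SimpleGraph.maximumIndepSet_exists

end

end DoobGraph

/-! ### The two bounds combined -/

open DoobGraph in
theorem theorem1 :
    ∃ ε : ℕ × ℕ → ℝ,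
      Filter.Tendsto ε (Filter.comap (fun p : ℕ × ℕ => 2 * p.1 + p.2) Filter.atTop) (nhds 0) ∧
      ∀ m n : ℕ,
        (DoobGraph.numMDS m n : ℝ) =
          (2 : ℝ) ^ ((2 : ℝ) ^ (2 * (m : ℝ) + (n : ℝ) - 1) * (1 + ε (m, n))) := by
  -- `ε` is obtained by solving the identity, which holds for all `m` and `n` since the count is
  -- positive; the content is the limit.
  refine ⟨fun p => Real.logb 2 (numMDS p.1 p.2) / (2 : ℝ) ^ (2 * (p.1 : ℝ) + (p.2 : ℝ) - 1) - 1,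
    ?_, fun m n => ?_⟩
  · rw [Metric.tendsto_nhds]
    intro η hη
    have hev := (eventuallyBounded_of_pos (half_pos hη)).and (Filter.eventually_ge_atTop 1)
    filter_upwards [Filter.tendsto_comap.eventually hev] with p hp
    obtain ⟨m, n⟩ := p
    obtain ⟨hbound, hN⟩ := hp
    dsimp only at hbound hN ⊢
    have hpow : (2 : ℝ) ^ (2 * (m : ℝ) + (n : ℝ) - 1) = 2 ^ (2 * m + n) / 2 := by
      rw [Real.rpow_sub (by norm_num), Real.rpow_one, ← Real.rpow_natCast]
      push_cast
      rfl
    have hH : (0 : ℝ) < 2 ^ (2 * m + n) / 2 := by positivity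
    have hpos : (0 : ℝ) < numMDS m n := by exact_mod_cast numMDS_pos m n
    have hlow : (2 : ℝ) ^ (2 * m + n) / 2 ≤ Real.logb 2 (numMDS m n) := by
      rw [Real.le_logb_iff_rpow_le (by norm_num) hpos]
      have h1 : (2 : ℝ) ^ (2 * m + n) / 2 = ((2 ^ (2 * m + n - 1) : ℕ) : ℝ) := by
        obtain ⟨k, hk⟩ := Nat.exists_eq_add_of_le' hN
        rw [hk, pow_succ]
        simp
      rw [h1, Real.rpow_natCast]
      exact_mod_cast two_pow_le_numMDS hN
    have hup : Real.logb 2 (numMDS m n) ≤ (1 + η / 2) * (2 ^ (2 * m + n) / 2) := by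
      rw [Real.logb_le_iff_le_rpow (by norm_num) hpos]
      refine le_trans ?_ hbound
      rw [numMDS_eq hN]
      exact_mod_cast card_quarterSets_doob_le_codeNum hN
    rw [hpow, Real.dist_eq, sub_zero, abs_lt]
    have h1 : 1 ≤ Real.logb 2 (numMDS m n) / (2 ^ (2 * m + n) / 2) := (one_le_div hH).2 hlow
    have h2 : Real.logb 2 (numMDS m n) / (2 ^ (2 * m + n) / 2) ≤ 1 + η / 2 :=
      (div_le_iff₀ hH).2 hup
    constructor <;> linarith
  · have hpos : (0 : ℝ) < numMDS m n := by exact_mod_cast numMDS_pos m n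
    have hH : (0 : ℝ) < (2 : ℝ) ^ (2 * (m : ℝ) + (n : ℝ) - 1) := by positivity
    dsimp only
    rw [add_sub_cancel, mul_div_cancel₀ _ hH.ne', Real.rpow_logb (by norm_num) (by norm_num) hpos]
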